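/- Let $(X,\mathcal A,\mu)$ be a probability space, $1\le n\le m$ integers, $V_n\subset L^2(X,\mu)$ a complex subspace of dimension $n$, and $\varphi=(\varphi_1,\dots,\varphi_n)$ measurable functions $X\to\mathbb C$ forming an orthonormal basis of $V_n$; regard $\varphi(x)$ as a column vector in $\mathbb C^n$. Let $f:X\to\mathbb C$ be measurable. For points $x_1,\dots,x_m\in X$ and weights $s_1,\dots,s_m>0$ let $P_n^mf\in V_n$ denote a minimizer over $v\in V_n$ of $\sum_{i=1}^m s_i|f(x_i)-v(x_i)|^2$, elements of $V_n$ being evaluated as linear combinations of $\varphi_1,\dots,\varphi_n$. An error equal to $+\infty$ is allowed on the right-hand sides below. Both algorithms start from $A_0=0\in\mathbb C^{n\times n}$, $\ell_0=-n$, and for $i=1,\dots,m$ set $Y_i=(A_{i-1}-\ell_{i-1}I)^{-1}$, $\ell_i=\ell_{i-1}+\delta_i$, $Z_i=(A_{i-1}-\ell_iI)^{-1}$, draw $x_i$ given $x_1,\dots,x_{i-1}$ from a probability density with respect to $\mu$, choose a weight $s_i$, and set $A_i=A_{i-1}+s_i\varphi(x_i)\varphi(x_i)^*$. *Algorithm 1*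 (inputs $\varepsilon\in(0,1)$, $\gamma\ge0$): $\delta_i=\varepsilon/(\operatorname{Tr}Y_i+\gamma)$; with $\rho_i(x)=\varphi(x)^*(Z_i+\tfrac{\gamma}{n}I)\varphi(x)$, the density is $\rho_i/(\operatorname{Tr}Z_i+\gamma)$ and $s_i=\frac{\varepsilon}{1-\varepsilon}\,/\,\rho_i(x_i)$. *Algorithm 2* (inputs $\delta\in(0,1)$, $\kappa\in[0,1]$): $\delta_i=\delta$; with $W_i=(\operatorname{Tr}Z_i-\operatorname{Tr}Y_i)^{-1}Z_i^2-Z_i$, $w_i(x)=\varphi(x)^*W_i\varphi(x)$ and $R_i(x)=w_i(x)\mathbf 1_{w_i(x)\ge\kappa(1-\delta)/\delta}$, the density is $R_i/\int_XR_i\,d\mu$ and $s_i=1/R_i(x_i)$. **(1)** Let $r=\frac{m+1}{n}>1$. Algorithm 1 with $\varepsilon=r^{-1/4}$ and $\gamma=r^{1/2}-r^{1/4}$ is well defined: points $x_1,\dots,x_m$ with the prescribed conditional densities exist. For any such random points, almost surely all $s_i>0$; the event $E=\{A_m\succcurlyeq n(r^{1/4}-1)I\}$ has probability at least $1-r^{-1/4}>0$;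 almost surely on $E$ the estimator $P_n^mf$ is unique; and $\tilde f=P_n^mf\,|\,E$ (that is, $P_n^mf$ under the conditional probability given $E$) satisfies $$\mathbb E\big(\|f-\tilde f\|_{L^2}^2\big)=\mathbb E\big(\|f-P_n^mf\|_{L^2}^2\,\big|\,E\big)\le\Big(1+\frac{1}{r(1-r^{-1/4})^7}\Big)\min_{v\in V_n}\|f-v\|_{L^2}^2 .$$ **(2)** Suppose $n\ge2$, and let $r=\frac{m}{n-1}>1$ and $\kappa\in[0,1]$. Algorithm 2 with inputs $\delta=r^{-1/2}$ and $\kappa$ is well defined in the same sense. For any such random points, almost surely all $s_i>0$ and $\tilde f=P_n^mf$ is unique, and simultaneously: if $\kappa<1$, then $$\mathbb E\big(\|f-\tilde f\|_{L^2}^2\big)\le\Big(1+\frac1{1-\kappa}\,\frac1{(1-1/\sqrt r)^2}\Big)\min_{v\in V_n}\|f-v\|_{L^2}^2 ;$$ if $\kappa>0$ and $V_n\subset L^\infty$, then $$\|f-\tilde f\|_{L^2}\le\Big(1+\frac1{\sqrt\kappa}\,\frac1{1-1/\sqrt r}\Big)\min_{v\in V_n}\|f-v\|_{L^\infty}\quad\text{almost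 surely.}$$ -/

import Mathlib

open MeasureTheory
open scoped ENNReal Matrix ComplexOrder

noncomputable section

namespace BarrierSampling

/-- The current matrix `A` and the current lower barrier `ℓ` of a sampling algorithm. -/
structure State (n : ℕ) where
  A : Matrix (Fin n) (Fin n) ℂ
  barrier : ℝ

/-- The initial state `A₀ = 0`, `ℓ₀ = -n`. -/
def State.init (n : ℕ) : State n := ⟨0, -(n : ℝ)⟩

/-- `(A - ℓ I)⁻¹`. -/
def resolvent {n : ℕ} (A : Matrix (Fin n) (Fin n) ℂ) (l : ℝ) : Matrix (Fin n) (Fin n) ℂ :=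
  (A - (l : ℂ) • (1 : Matrix (Fin n) (Fin n) ℂ))⁻¹

/-- The trace, as a real number (it is only used for Hermitian matrices). -/
def rtrace {n : ℕ} (M : Matrix (Fin n) (Fin n) ℂ) : ℝ := M.trace.re

/-- The vector `φ(x) ∈ ℂⁿ`. -/
def vec {X : Type*} {n : ℕ} (φ : Fin n → X → ℂ) (x : X) : Fin n → ℂ := fun j => φ j x

/-- `φ(x)^* M φ(x)`, as a real number (it is only used for Hermitian `M`). -/
def qform {X : Type*} {n : ℕ} (φ : Fin n → X → ℂ) (M : Matrix (Fin n) (Fin n) ℂ) (x : X) : ℝ :=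
  (star (vec φ x) ⬝ᵥ (M *ᵥ vec φ x)).re

/-- One iteration of a sampling algorithm: from the current state it computes the next barrier,
the density (with respect to `μ`) from which the next point is drawn, and the weight that is
given to the drawn point. -/
structure Sampler (X : Type*) (n : ℕ) where
  nextBarrier : State n → ℝ
  density : State n → X → ℝ
  weight : State n → X → ℝ

namespace Sampler

variable {X : Type*} {n : ℕ}

/-- The state after the first `k` points have been drawn:
`A_k = A_{k-1} + s_k φ(x_k) φ(x_k)^*`. -/
def state (φ : Fin n → X → ℂ) (S : Sampler X n) : (k : ℕ) → (Fin k → X) → State n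
  | 0, _ => State.init n
  | k + 1, h =>
    let st := state φ S k (Fin.init h)
    let x := h (Fin.last k)
    ⟨st.A + (S.weight st x : ℂ) • Matrix.vecMulVec (vec φ x) (star (vec φ x)),
      S.nextBarrier st⟩

/-- The state at the beginning of iteration `i`; it depends only on the points drawn before. -/
def stateBefore (φ : Fin n → X → ℂ) (S : Sampler X n) {m : ℕ} (t : Fin m → X) (i : Fin m) :
    State n :=
  S.state φ i (Fin.take (i : ℕ) i.isLt.le t)

/-- The weights `s_1, …, s_m` produced along with the points `t_1, …, t_m`. -/
def weights (φ : Fin n → X → ℂ) (S : Sampler X n) {m : ℕ} (t : Fin m → X) (i : Fin m) : ℝ :=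
  S.weight (S.stateBefore φ t i) (t i)

/-- The output matrix `A_m`. -/
def finalMatrix (φ : Fin n → X → ℂ) (S : Sampler X n) {m : ℕ} (t : Fin m → X) :
    Matrix (Fin n) (Fin n) ℂ :=
  (S.state φ m t).A

/-- The random points `x = (x_1, …, x_m)` on the probability space `(Ω, P)` are drawn by the
algorithm: for every `i`, the conditional distribution of `x_i` given `(x_1, …, x_{i-1})`
has, with respect to `μ`, the density prescribed at iteration `i`. -/
def IsSample [MeasurableSpace X] (μ : Measure X) (φ : Fin n → X → ℂ) (S : Sampler X n)
    {m : ℕ} {Ω : Type*} [MeasurableSpace Ω] (P : Measure Ω) (x : Ω → Fin m → X) : Prop :=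
  Measurable x ∧
    ∀ (i : Fin m) (H : Set (Fin (i : ℕ) → X)) (B : Set X), MeasurableSet H → MeasurableSet B →
      P {ω | Fin.take (i : ℕ) i.isLt.le (x ω) ∈ H ∧ x ω i ∈ B} =
        ∫⁻ ω in {ω | Fin.take (i : ℕ) i.isLt.le (x ω) ∈ H},
          ∫⁻ y in B, ENNReal.ofReal (S.density (S.stateBefore φ (x ω) i) y) ∂μ ∂P

end Sampler

/-! ### Random sampling by effective resistance -/

section EffectiveResistance

variable {X : Type*} {n : ℕ} (φ : Fin n → X → ℂ) (ε γ : ℝ)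

/-- `ℓ_i = ℓ_{i-1} + ε / (Tr Y_i + γ)`. -/
def erBarrier (st : State n) : ℝ :=
  st.barrier + ε / (rtrace (resolvent st.A st.barrier) + γ)

/-- `Z_i = (A_{i-1} - ℓ_i I)⁻¹`. -/
def erZ (st : State n) : Matrix (Fin n) (Fin n) ℂ := resolvent st.A (erBarrier ε γ st)

/-- `ρ_i(x) = φ(x)^* (Z_i + γ I / n) φ(x)`. -/
def erRho (st : State n) (x : X) : ℝ :=
  qform φ (erZ ε γ st + ((γ / n : ℝ) : ℂ) • (1 : Matrix (Fin n) (Fin n) ℂ)) x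

/-- Draw `x_i` from the density `ρ_i / (Tr Z_i + γ)`, with weight `s_i = η / ρ_i(x_i)`, where
`η = ε / (1 - ε)`. -/
def effectiveResistance : Sampler X n where
  nextBarrier := erBarrier ε γ
  density := fun st x => erRho φ ε γ st x / (rtrace (erZ ε γ st) + γ)
  weight := fun st x => (ε / (1 - ε)) / erRho φ ε γ st x

end EffectiveResistance

/-! ### Random sampling with fixed increments of the barrier -/

section FixedIncrements

variable {X : Type*} {n : ℕ} (φ : Fin n → X → ℂ) (δ κ : ℝ)

/-- `W_i = (Tr Z_i - Tr Y_i)⁻¹ Z_i² - Z_i`, where `Y_i = (A_{i-1} - ℓ_{i-1} I)⁻¹` and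
`Z_i = (A_{i-1} - (ℓ_{i-1} + δ) I)⁻¹`. -/
def fiW (st : State n) : Matrix (Fin n) (Fin n) ℂ :=
  let Y := resolvent st.A st.barrier
  let Z := resolvent st.A (st.barrier + δ)
  (((rtrace Z - rtrace Y)⁻¹ : ℝ) : ℂ) • Z ^ 2 - Z

open Classical in
/-- `R_i(x) = w_i(x)` where `w_i(x) = φ(x)^* W_i φ(x) ≥ κ (1 - δ) / δ`, and `0` elsewhere. -/
def fiR (st : State n) (x : X) : ℝ :=
  if κ * ((1 - δ) / δ) ≤ qform φ (fiW δ st) x then qform φ (fiW δ st) x else 0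

/-- Draw `x_i` from the density `R_i / ∫ R_i dμ`, with weight `s_i = 1 / R_i(x_i)`. -/
def fixedIncrements [MeasurableSpace X] (μ : Measure X) : Sampler X n where
  nextBarrier := fun st => st.barrier + δ
  density := fun st x => fiR φ δ κ st x / ∫ y, fiR φ δ κ st y ∂μ
  weight := fun st x => 1 / fiR φ δ κ st x

end FixedIncrements

/-! ### Approximation in a subspace of `L²` -/

section LeastSquares

variable {X : Type*} [MeasurableSpace X] {μ : Measure X} {n : ℕ}
  {V : Submodule ℂ (Lp ℂ 2 μ)}

/-- `inf_{v ∈ V} ‖f - v‖_{L^p}`; it is `∞` if `f - v` is in `L^p` for no `v ∈ V`. The infimum is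
a minimum for finite-dimensional `V`. -/
def bestError (V : Submodule ℂ (Lp ℂ 2 μ)) (p : ℝ≥0∞) (f : X → ℂ) : ℝ≥0∞ :=
  ⨅ v : V, eLpNorm (fun y => f y - ((v : Lp ℂ 2 μ) : X → ℂ) y) p μ

/-- `‖f - v‖_{L²}` for `v ∈ V`. -/
def errL2 (f : X → ℂ) (v : V) : ℝ≥0∞ :=
  eLpNorm (fun y => f y - ((v : Lp ℂ 2 μ) : X → ℂ) y) 2 μ

/-- The value at `x` of `v = ∑ c_j φ_j ∈ V`, where the functions `φ_j : X → ℂ` are versions of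
the orthonormal basis `b` of `V`. -/
def evalAt (b : OrthonormalBasis (Fin n) ℂ V) (φ : Fin n → X → ℂ) (v : V) (x : X) : ℂ :=
  ∑ j, b.repr v j * φ j x

/-- `v` minimizes `∑ s_i |f(t_i) - v(t_i)|²` over `V`. -/
def IsLeastSquares (b : OrthonormalBasis (Fin n) ℂ V) (φ : Fin n → X → ℂ) (f : X → ℂ) {m : ℕ}
    (s : Fin m → ℝ) (t : Fin m → X) (v : V) : Prop :=
  ∀ u : V, ∑ i, s i * ‖f (t i) - evalAt b φ v (t i)‖ ^ 2 ≤
    ∑ i, s i * ‖f (t i) - evalAt b φ u (t i)‖ ^ 2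

end LeastSquares

end BarrierSampling

end

/-! Both algorithms randomize the barrier method of Batson, Spielman and Srivastava. The potential
Tr (A - ℓI)⁻¹ starts at 1. Raising the barrier increases it by Tr Z - Tr Y, and adding s φ(x)φ(x)^*
lowers it by s φ^*Z²φ / (1 + s φ^*Zφ) (Sherman-Morrison, `rtrace_inv_add_rankOne`). Orthonormality
gives ∫ φ^*Mφ dμ = Tr M (`integral_qform`), so mean gain and mean loss are compared through the
trace inequality `rtrace_sub_mul_le`.

Effective resistance: the potential is a supermartingale (`lintegral_potential_le`), so its values
before the m + 1 barrier moves have total mean at most m + 1. Markov's inequality and Cauchy-Schwarz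
then make the sum of the increments ε / (potential + γ) large with the required probability
(`le_measure_finalMatrix`).

Fixed increments: the weight 1 / w is exactly the one for which loss equals gain, so the potential
stays 1 (`UnitPotential.next`) and A_m exceeds the final barrier by at least 1. The bound Tr W > (1
- δ)/δ (`UnitPotential.lt_rtrace_fiW`) leaves enough mass after truncation.

A bound A_m ≽ cI says c‖v‖² ≤ ∑ s_i |v(x_i)|² on V. Let w be the best approximation of f, g = f - w,
and v the estimator; then ‖f - v‖² = ‖g‖² + ‖v - w‖². For effective resistance, c²‖v - w‖² is at
most the squared residual of the normal equations, a sum of martingale increments because g ⟂ V, and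
its second moment is a sum of variances. For fixed increments, c‖v - w‖² ≤ ∑ s_i |g(x_i)|², which is
bounded in mean because density times weight is constant where the density is positive, and almost
surely because truncation bounds the weights. -/

noncomputable section

namespace BarrierSampling

/-! ### Resolvents in an eigenbasis -/

section Spectral

variable {n : ℕ} {A : Matrix (Fin n) (Fin n) ℂ}

/-- `A` shifted by `l`, diagonalized in an eigenbasis of `A`. -/
theorem sub_smul_one_eq_conj (hA : A.IsHermitian) (l : ℝ) :
    A - (l : ℂ) • (1 : Matrix (Fin n) (Fin n) ℂ) =
      Unitary.conjStarAlgAut ℂ _ hA.eigenvectorUnitary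
        (Matrix.diagonal fun j => ((hA.eigenvalues j - l : ℝ) : ℂ)) := by
  have h : (Matrix.diagonal fun j => ((hA.eigenvalues j - l : ℝ) : ℂ)) =
      Matrix.diagonal (RCLike.ofReal ∘ hA.eigenvalues) -
        (l : ℂ) • (1 : Matrix (Fin n) (Fin n) ℂ) := by
    ext i j
    by_cases hij : i = j
    · subst hij; simp
    · simp [hij]
  rw [h, map_sub, map_smul, map_one, ← hA.spectral_theorem]

theorem posSemidef_sub_iff (hA : A.IsHermitian) (l : ℝ) :
    (A - (l : ℂ) • (1 : Matrix (Fin n) (Fin n) ℂ)).PosSemidef ↔ ∀ j, l ≤ hA.eigenvalues j := by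
  rw [sub_smul_one_eq_conj hA, Unitary.conjStarAlgAut_apply,
    Matrix.IsUnit.posSemidef_star_right_conjugate_iff (Unitary.isUnit_coe),
    Matrix.posSemidef_diagonal_iff]
  simp only [Complex.zero_le_real, sub_nonneg]

theorem posDef_sub_iff (hA : A.IsHermitian) (l : ℝ) :
    (A - (l : ℂ) • (1 : Matrix (Fin n) (Fin n) ℂ)).PosDef ↔ ∀ j, l < hA.eigenvalues j := by
  rw [sub_smul_one_eq_conj hA, Unitary.conjStarAlgAut_apply,
    Matrix.IsUnit.posDef_star_right_conjugate_iff (Unitary.isUnit_coe),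
    Matrix.posDef_diagonal_iff]
  simp only [Complex.zero_lt_real, sub_pos]

theorem resolvent_eq_conj (hA : A.IsHermitian) {l : ℝ} (hl : ∀ j, l < hA.eigenvalues j) :
    resolvent A l = Unitary.conjStarAlgAut ℂ _ hA.eigenvectorUnitary
        (Matrix.diagonal fun j => (((hA.eigenvalues j - l)⁻¹ : ℝ) : ℂ)) := by
  refine Matrix.inv_eq_right_inv ?_
  rw [sub_smul_one_eq_conj hA, ← map_mul, Matrix.diagonal_mul_diagonal]
  have : (Matrix.diagonal fun j => ((hA.eigenvalues j - l : ℝ) : ℂ) *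
      (((hA.eigenvalues j - l)⁻¹ : ℝ) : ℂ)) = 1 := by
    rw [← Matrix.diagonal_one]
    congr 1
    funext j
    rw [← Complex.ofReal_mul, mul_inv_cancel₀ (sub_pos.2 (hl j)).ne', Complex.ofReal_one]
  rw [this, map_one]

theorem trace_conjStarAlgAut (U : unitary (Matrix (Fin n) (Fin n) ℂ))
    (M : Matrix (Fin n) (Fin n) ℂ) :
    (Unitary.conjStarAlgAut ℂ _ U M).trace = M.trace := by
  rw [Unitary.conjStarAlgAut_apply, Matrix.trace_mul_cycle, Unitary.coe_star_mul_self, one_mul]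

theorem rtrace_resolvent (hA : A.IsHermitian) {l : ℝ} (hl : ∀ j, l < hA.eigenvalues j) :
    rtrace (resolvent A l) = ∑ j, (hA.eigenvalues j - l)⁻¹ := by
  rw [rtrace, resolvent_eq_conj hA hl, trace_conjStarAlgAut, Matrix.trace_diagonal,
    ← Complex.ofReal_sum, Complex.ofReal_re]

theorem rtrace_resolvent_sq (hA : A.IsHermitian) {l : ℝ} (hl : ∀ j, l < hA.eigenvalues j) :
    rtrace (resolvent A l ^ 2) = ∑ j, (hA.eigenvalues j - l)⁻¹ ^ 2 := by
  rw [rtrace, resolvent_eq_conj hA hl, ← map_pow, trace_conjStarAlgAut, Matrix.diagonal_pow,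
    Matrix.trace_diagonal]
  simp only [Pi.pow_apply, ← Complex.ofReal_pow, ← Complex.ofReal_sum, Complex.ofReal_re]

theorem isHermitian_of_sub {l : ℝ}
    (h : (A - (l : ℂ) • (1 : Matrix (Fin n) (Fin n) ℂ)).IsHermitian) : A.IsHermitian := by
  have h1 : ((l : ℂ) • (1 : Matrix (Fin n) (Fin n) ℂ)).IsHermitian := by
    simp [Matrix.IsHermitian, Matrix.conjTranspose_smul]
  simpa using h.add h1

end Spectral

/-! ### Scalar inequalities for shifted inverses -/

section Scalar

variable {n : ℕ} (a : Fin n → ℝ) {δ : ℝ}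

/-- The resolvent identity Z - Y = δYZ on a single eigenvalue. -/
theorem inv_sub_sub_inv {a δ : ℝ} (h0 : 0 < a) (h : δ < a) :
    (a - δ)⁻¹ - a⁻¹ = δ * (a⁻¹ * (a - δ)⁻¹) := by
  have : a - δ ≠ 0 := (sub_pos.2 h).ne'
  field_simp
  ring

/-- A form of Chebyshev's sum inequality for `y = 1 / a` and `z = 1 / (a - δ)`. -/
theorem sum_mul_sum_le_of_inv (hδ : 0 ≤ δ) (h0 : ∀ j, 0 < a j) (h : ∀ j, δ < a j) :
    (∑ j, (a j)⁻¹ * (a j - δ)⁻¹) * ∑ j, (a j - δ)⁻¹ ≤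
      (∑ j, (a j - δ)⁻¹ ^ 2) * ∑ j, (a j)⁻¹ := by
  set y : Fin n → ℝ := fun j => (a j)⁻¹
  set z : Fin n → ℝ := fun j => (a j - δ)⁻¹
  have hy : ∀ j, 0 < y j := fun j => inv_pos.2 (h0 j)
  have hz : ∀ j, z j = y j + δ * (y j * z j) := fun j => by
    have := inv_sub_sub_inv (h0 j) (h j)
    simp only [y, z]
    linarith
  -- Symmetrization: the (j, k) and (k, j) terms of the difference of the two double sums add up to
  -- δ y_j y_k (z_j - z_k)².
  have key : ∀ j k, 0 ≤ (z j ^ 2 * y k - y j * z j * z k) + (z k ^ 2 * y j - y k * z k * z j) := by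
    intro j k
    have h1 : z j * y k - z k * y j = δ * (y j * y k) * (z j - z k) := by
      linear_combination y k * hz j - y j * hz k
    have h2 : (z j ^ 2 * y k - y j * z j * z k) + (z k ^ 2 * y j - y k * z k * z j)
        = δ * (y j * y k) * (z j - z k) ^ 2 := by
      linear_combination (z j - z k) * h1
    rw [h2]
    have := hy j
    have := hy k
    positivity
  have e1 : (∑ j, y j * z j) * ∑ j, z j = ∑ j, ∑ k, y j * z j * z k := Finset.sum_mul_sum ..
  have e2 : (∑ j, z j ^ 2) * ∑ j, y j = ∑ j, ∑ k, z j ^ 2 * y k := Finset.sum_mul_sum ..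
  have e3 : ∑ j, ∑ k, ((z j ^ 2 * y k - y j * z j * z k) + (z k ^ 2 * y j - y k * z k * z j)) =
      2 * (∑ j, ∑ k, z j ^ 2 * y k - ∑ j, ∑ k, y j * z j * z k) := by
    simp_rw [Finset.sum_add_distrib, Finset.sum_sub_distrib]
    rw [Finset.sum_comm (f := fun j k => z k ^ 2 * y j),
      Finset.sum_comm (f := fun j k => y k * z k * z j)]
    ring
  have e4 := Finset.sum_nonneg fun j (_ : j ∈ Finset.univ) =>
    Finset.sum_nonneg fun k (_ : k ∈ Finset.univ) => key j k
  rw [e3] at e4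
  rw [e1, e2]
  linarith

theorem sum_inv_sub_sub (h0 : ∀ j, 0 < a j) (h : ∀ j, δ < a j) :
    ∑ j, (a j - δ)⁻¹ - ∑ j, (a j)⁻¹ = δ * ∑ j, (a j)⁻¹ * (a j - δ)⁻¹ := by
  rw [← Finset.sum_sub_distrib, Finset.mul_sum]
  exact Finset.sum_congr rfl fun j _ => inv_sub_sub_inv (h0 j) (h j)

theorem sum_inv_mul_inv_le (hδ : 0 ≤ δ) (h : ∀ j, δ < a j) :
    ∑ j, (a j)⁻¹ * (a j - δ)⁻¹ ≤ ∑ j, (a j - δ)⁻¹ ^ 2 := by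
  refine Finset.sum_le_sum fun j _ => ?_
  have : 0 < a j - δ := sub_pos.2 (h j)
  rw [sq]
  gcongr
  linarith

end Scalar

/-! ### Moving the barrier -/

section Barrier

variable {n : ℕ} {A : Matrix (Fin n) (Fin n) ℂ} {l δ : ℝ}

/-- The matrix `A` is (strictly) above the barrier `l`. -/
abbrev Above (A : Matrix (Fin n) (Fin n) ℂ) (l : ℝ) : Prop :=
  (A - (l : ℂ) • (1 : Matrix (Fin n) (Fin n) ℂ)).PosDef

theorem Above.isHermitian (h : Above A l) : A.IsHermitian := isHermitian_of_sub h.1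

theorem Above.mono {l' : ℝ} (h : Above A l) (hl : l' ≤ l) : Above A l' := by
  have hA := h.isHermitian
  exact (posDef_sub_iff hA l').2 fun j => hl.trans_lt ((posDef_sub_iff hA l).1 h j)

theorem Above.posSemidef {l' : ℝ} (h : Above A l) (hl : l' ≤ l) :
    (A - (l' : ℂ) • (1 : Matrix (Fin n) (Fin n) ℂ)).PosSemidef :=
  Matrix.PosDef.posSemidef (h.mono hl)

theorem Above.rtrace_nonneg (h : Above A l) : 0 ≤ rtrace (resolvent A l) := by
  have h' := (posDef_sub_iff h.isHermitian l).1 h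
  rw [rtrace_resolvent h.isHermitian h']
  exact Finset.sum_nonneg fun j _ => inv_nonneg.2 (sub_pos.2 (h' j)).le

theorem Above.rtrace_pos (hn : 1 ≤ n) (h : Above A l) : 0 < rtrace (resolvent A l) := by
  have h' := (posDef_sub_iff h.isHermitian l).1 h
  rw [rtrace_resolvent h.isHermitian h']
  have : Nonempty (Fin n) := ⟨⟨0, hn⟩⟩
  exact Finset.sum_pos (fun j _ => inv_pos.2 (sub_pos.2 (h' j))) Finset.univ_nonempty

/-- Every eigenvalue of `A - l` is at least `1 / Tr (A - l)⁻¹`. -/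
theorem Above.inv_rtrace_le (h : Above A l) (j : Fin n) :
    (rtrace (resolvent A l))⁻¹ ≤ h.isHermitian.eigenvalues j - l := by
  have h' := (posDef_sub_iff h.isHermitian l).1 h
  rw [rtrace_resolvent h.isHermitian h']
  refine inv_le_of_inv_le₀ (sub_pos.2 (h' j)) ?_
  exact Finset.single_le_sum (f := fun j => (h.isHermitian.eigenvalues j - l)⁻¹)
    (fun k _ => inv_nonneg.2 (sub_pos.2 (h' k)).le) (Finset.mem_univ j)

/-- When the potential is 1, this gains a full unit above the barrier; it supplies the final bound
for fixed increments. -/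
theorem Above.posSemidef_inv_rtrace (h : Above A l) :
    (A - ((l + (rtrace (resolvent A l))⁻¹ : ℝ) : ℂ) •
      (1 : Matrix (Fin n) (Fin n) ℂ)).PosSemidef := by
  rw [posSemidef_sub_iff h.isHermitian]
  intro j
  linarith [h.inv_rtrace_le j]

/-- The smallest eigenvalue of A - ℓI is at least the inverse of the potential, so a shorter move
cannot reach the spectrum. -/
theorem Above.add (hn : 1 ≤ n) (h : Above A l) (hδ : δ * rtrace (resolvent A l) < 1) :
    Above A (l + δ) := by
  rw [Above, posDef_sub_iff h.isHermitian]
  intro j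
  have h1 := h.inv_rtrace_le j
  have h2 : δ < (rtrace (resolvent A l))⁻¹ := by
    rwa [← one_div, lt_div_iff₀ (h.rtrace_pos hn)]
  linarith

/-- The comparison of traces behind the control of the potential. -/
theorem rtrace_sub_mul_le (h : Above A l) (h' : Above A (l + δ)) (hδ : 0 ≤ δ) {γ : ℝ}
    (hγ : 0 ≤ γ) :
    (rtrace (resolvent A (l + δ)) - rtrace (resolvent A l)) *
        (rtrace (resolvent A (l + δ)) + γ) ≤
      δ * (rtrace (resolvent A l) + γ) * rtrace (resolvent A (l + δ) ^ 2) := by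
  have hA := h.isHermitian
  have h1 := (posDef_sub_iff hA l).1 h
  have h2 := (posDef_sub_iff hA (l + δ)).1 h'
  rw [rtrace_resolvent hA h1, rtrace_resolvent hA h2, rtrace_resolvent_sq hA h2]
  simp_rw [← sub_sub]
  have h0 : ∀ j, 0 < hA.eigenvalues j - l := fun j => sub_pos.2 (h1 j)
  have h3 : ∀ j, δ < hA.eigenvalues j - l := fun j => by linarith [h2 j]
  rw [sum_inv_sub_sub _ h0 h3]
  -- The claim is affine in γ: `c1` is the part without γ, `c2` the part proportional to γ.
  have c1 := sum_mul_sum_le_of_inv _ hδ h0 h3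
  have c2 := mul_le_mul_of_nonneg_left (sum_inv_mul_inv_le _ hδ h3) hγ
  have := mul_le_mul_of_nonneg_left (add_le_add c1 c2) hδ
  linarith

theorem rtrace_lt_rtrace_add (hn : 1 ≤ n) (h : Above A l) (h' : Above A (l + δ)) (hδ : 0 < δ) :
    rtrace (resolvent A l) < rtrace (resolvent A (l + δ)) := by
  have hA := h.isHermitian
  have h1 := (posDef_sub_iff hA l).1 h
  have h2 := (posDef_sub_iff hA (l + δ)).1 h'
  rw [rtrace_resolvent hA h1, rtrace_resolvent hA h2]
  have : Nonempty (Fin n) := ⟨⟨0, hn⟩⟩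
  refine Finset.sum_lt_sum_of_nonempty Finset.univ_nonempty fun j _ => ?_
  exact inv_strictAnti₀ (by linarith [h2 j]) (by linarith)

theorem above_init (hn : 1 ≤ n) : Above (State.init n).A (State.init n).barrier := by
  have : (0 : ℂ) < n := by exact_mod_cast hn
  simpa [State.init, Above] using Matrix.PosDef.one.smul this

/-- Here A₀ - ℓ₀I = nI: the choice ℓ₀ = -n normalizes the potential to 1. -/
theorem rtrace_resolvent_init (hn : 1 ≤ n) :
    rtrace (resolvent (State.init n).A (State.init n).barrier) = 1 := by
  have hn' : (n : ℂ) ≠ 0 := by exact_mod_cast (by omega : n ≠ 0)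
  have : resolvent (State.init n).A (State.init n).barrier =
      (n : ℂ)⁻¹ • (1 : Matrix (Fin n) (Fin n) ℂ) := by
    refine Matrix.inv_eq_right_inv ?_
    simp [State.init, smul_smul, hn']
  rw [rtrace, this]
  simp [hn']

end Barrier

/-! ### Rank-one updates -/

section RankOne

variable {X : Type*} {n : ℕ} (φ : Fin n → X → ℂ)

theorem ofReal_qform {M : Matrix (Fin n) (Fin n) ℂ} (hM : M.IsHermitian) (x : X) :
    ((qform φ M x : ℝ) : ℂ) = star (vec φ x) ⬝ᵥ (M *ᵥ vec φ x) := by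
  refine Complex.ext (by simp [qform]) ?_
  have := hM.im_star_dotProduct_mulVec_self (vec φ x)
  simpa using this.symm

theorem qform_nonneg {M : Matrix (Fin n) (Fin n) ℂ} (hM : M.PosSemidef) (x : X) :
    0 ≤ qform φ M x := hM.re_dotProduct_nonneg (vec φ x)

theorem qform_add (M N : Matrix (Fin n) (Fin n) ℂ) (x : X) :
    qform φ (M + N) x = qform φ M x + qform φ N x := by
  simp [qform, Matrix.add_mulVec]

theorem qform_sub (M N : Matrix (Fin n) (Fin n) ℂ) (x : X) :
    qform φ (M - N) x = qform φ M x - qform φ N x := by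
  simp [qform, Matrix.sub_mulVec]

theorem qform_smul (c : ℝ) (M : Matrix (Fin n) (Fin n) ℂ) (x : X) :
    qform φ ((c : ℂ) • M) x = c * qform φ M x := by
  simp [qform, Matrix.smul_mulVec]

theorem qform_one (x : X) : qform φ 1 x = ∑ j, ‖φ j x‖ ^ 2 := by
  simp [qform, dotProduct, vec, Complex.sq_norm, Complex.normSq_apply]

/-- The trace form of the Sherman-Morrison formula. -/
theorem rtrace_inv_add_rankOne {C : Matrix (Fin n) (Fin n) ℂ} (hC : C.PosDef) {s : ℝ} (hs : 0 ≤ s)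
    (x : X) :
    rtrace ((C + (s : ℂ) • Matrix.vecMulVec (vec φ x) (star (vec φ x)))⁻¹) =
      rtrace C⁻¹ - s * qform φ (C⁻¹ ^ 2) x / (1 + s * qform φ C⁻¹ x) := by
  set v := vec φ x
  set Z := C⁻¹
  have hZ : Z.PosDef := hC.inv
  have hCZ : C * Z = 1 := Matrix.mul_nonsing_inv _ ((Matrix.isUnit_iff_isUnit_det _).1 hC.isUnit)
  have hq : 0 ≤ qform φ Z x := qform_nonneg φ hZ.posSemidef x
  have hpos : 0 < 1 + s * qform φ Z x := by positivity
  have hne : (1 : ℂ) + s * qform φ Z x ≠ 0 := by exact_mod_cast hpos.ne'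
  set c : ℂ := s / (1 + s * qform φ Z x)
  have hc : c * (1 + s * qform φ Z x) = s := div_mul_cancel₀ _ hne
  have hmid : Matrix.vecMulVec v (star v) * Z * Matrix.vecMulVec v (star v) =
      (qform φ Z x : ℂ) • Matrix.vecMulVec v (star v) := by
    rw [ofReal_qform φ hZ.isHermitian, Matrix.mul_assoc, Matrix.mul_vecMulVec,
      Matrix.vecMulVec_mul_vecMulVec, Matrix.vecMulVec_smul]
  -- Sherman-Morrison, verified by multiplying out; `hmid` collapses the product of two rank-one
  -- factors, and c is chosen so that the coefficient of MZ vanishes.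
  have hinv : (C + (s : ℂ) • Matrix.vecMulVec v (star v))⁻¹ =
      Z - c • (Z * Matrix.vecMulVec v (star v) * Z) := by
    refine Matrix.inv_eq_right_inv ?_
    set M := Matrix.vecMulVec v (star v)
    have e : (C + (s : ℂ) • M) * (Z - c • (Z * M * Z)) =
        C * Z - c • (C * Z * (M * Z)) + (s : ℂ) • (M * Z) - ((s : ℂ) * c) • (M * Z * M * Z) := by
      simp only [Matrix.add_mul, Matrix.mul_sub, Matrix.smul_mul, Matrix.mul_smul, mul_smul,
        Matrix.mul_assoc, smul_add, mul_comm (s : ℂ) c]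
      abel
    rw [e, hmid, hCZ, one_mul, Matrix.smul_mul, smul_smul]
    have : (1 : Matrix (Fin n) (Fin n) ℂ) - c • (M * Z) + (s : ℂ) • (M * Z) -
        ((s : ℂ) * c * (qform φ Z x : ℂ)) • (M * Z) =
        1 + ((s : ℂ) - c * (1 + s * qform φ Z x)) • (M * Z) := by
      module
    rw [this, hc]
    simp
  have htr : (Z * Matrix.vecMulVec v (star v) * Z).trace = ((qform φ (Z ^ 2) x : ℝ) : ℂ) := by
    rw [ofReal_qform φ (hZ.isHermitian.pow 2), Matrix.trace_mul_cycle, Matrix.mul_vecMulVec,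
      Matrix.trace_vecMulVec, sq, dotProduct_comm]
  rw [hinv, rtrace, rtrace, Matrix.trace_sub, Matrix.trace_smul, htr, Complex.sub_re]
  congr 1
  have : c • ((qform φ (Z ^ 2) x : ℝ) : ℂ) =
      ((s * qform φ (Z ^ 2) x / (1 + s * qform φ Z x) : ℝ) : ℂ) := by
    simp only [c, smul_eq_mul]
    push_cast
    ring
  rw [this, Complex.ofReal_re]

theorem Above.add_rankOne {A : Matrix (Fin n) (Fin n) ℂ} {l : ℝ} (h : Above A l) {s : ℝ}
    (hs : 0 ≤ s) (x : X) :
    Above (A + (s : ℂ) • Matrix.vecMulVec (vec φ x) (star (vec φ x))) l := by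
  have : (s : ℂ) • Matrix.vecMulVec (vec φ x) (star (vec φ x)) |>.PosSemidef :=
    (Matrix.posSemidef_vecMulVec_self_star _).smul (by exact_mod_cast hs)
  rw [Above, add_sub_right_comm]
  exact Matrix.PosDef.add_posSemidef h this

theorem rtrace_resolvent_add_rankOne {A : Matrix (Fin n) (Fin n) ℂ} {l : ℝ} (h : Above A l)
    {s : ℝ} (hs : 0 ≤ s) (x : X) :
    rtrace (resolvent (A + (s : ℂ) • Matrix.vecMulVec (vec φ x) (star (vec φ x))) l) =
      rtrace (resolvent A l) - s * qform φ (resolvent A l ^ 2) x /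
        (1 + s * qform φ (resolvent A l) x) := by
  rw [resolvent, add_sub_right_comm]
  exact rtrace_inv_add_rankOne φ h hs x

end RankOne

/-! ### Integrals of quadratic forms -/

section Orthonormal

theorem star_dotProduct_mulVec_vec {X : Type*} {n : ℕ} {φ : Fin n → X → ℂ}
    (M : Matrix (Fin n) (Fin n) ℂ) (x : X) :
    star (vec φ x) ⬝ᵥ (M *ᵥ vec φ x) = ∑ j, ∑ k, M j k * (star (φ j x) * φ k x) := by
  simp only [dotProduct, Matrix.mulVec, Finset.mul_sum]
  refine Finset.sum_congr rfl fun j _ => Finset.sum_congr rfl fun k _ => ?_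
  simp only [vec, Pi.star_apply]
  ring

variable {X : Type*} [MeasurableSpace X] {μ : Measure X} {n : ℕ}
  {V : Submodule ℂ (Lp ℂ 2 μ)} {b : OrthonormalBasis (Fin n) ℂ V} {φ : Fin n → X → ℂ}

theorem memLp_of_ae_eq_basis (hφ : ∀ j, φ j =ᵐ[μ] ((b j : Lp ℂ 2 μ) : X → ℂ)) (j : Fin n) :
    MemLp (φ j) 2 μ :=
  (memLp_congr_ae (hφ j)).2 (Lp.memLp _)

theorem integrable_star_mul_of_memLp {f g : X → ℂ} (hf : MemLp f 2 μ) (hg : MemLp g 2 μ) :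
    Integrable (fun x => star (f x) * g x) μ :=
  (MemLp.integrable_mul (p := 2) (q := 2) hf.star hg :)

theorem integrable_star_mul_basis (hφ : ∀ j, φ j =ᵐ[μ] ((b j : Lp ℂ 2 μ) : X → ℂ))
    (j k : Fin n) : Integrable (fun x => star (φ j x) * φ k x) μ :=
  integrable_star_mul_of_memLp (memLp_of_ae_eq_basis hφ j) (memLp_of_ae_eq_basis hφ k)

theorem integral_star_mul_basis (hφ : ∀ j, φ j =ᵐ[μ] ((b j : Lp ℂ 2 μ) : X → ℂ))
    (j k : Fin n) : ∫ x, star (φ j x) * φ k x ∂μ = if j = k then 1 else 0 := by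
  rw [← orthonormal_iff_ite.1 b.orthonormal j k, Submodule.coe_inner, L2.inner_def]
  refine integral_congr_ae ?_
  filter_upwards [hφ j, hφ k] with x hj hk
  rw [hj, hk, RCLike.inner_apply, mul_comm]
  rfl

theorem integrable_qform (hφ : ∀ j, φ j =ᵐ[μ] ((b j : Lp ℂ 2 μ) : X → ℂ))
    (M : Matrix (Fin n) (Fin n) ℂ) : Integrable (qform φ M) μ := by
  unfold qform
  simp_rw [star_dotProduct_mulVec_vec]
  exact (integrable_finsetSum _ fun j _ => integrable_finsetSum _ fun k _ =>
    (integrable_star_mul_basis hφ j k).const_mul _).re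

/-- Orthonormality says that φφ^* averages to the identity; this is what turns traces into
expectations under μ. -/
theorem integral_qform (hφ : ∀ j, φ j =ᵐ[μ] ((b j : Lp ℂ 2 μ) : X → ℂ))
    (M : Matrix (Fin n) (Fin n) ℂ) : ∫ x, qform φ M x ∂μ = rtrace M := by
  unfold qform
  simp_rw [star_dotProduct_mulVec_vec]
  have h : ∀ j k, Integrable (fun x => M j k * (star (φ j x) * φ k x)) μ :=
    fun j k => (integrable_star_mul_basis hφ j k).const_mul _
  have h' := integrable_finsetSum Finset.univ fun j _ =>
    integrable_finsetSum Finset.univ fun k _ => h j k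
  have e := integral_re h'
  simp only [RCLike.re_to_complex] at e
  rw [e, integral_finsetSum _ fun j _ => integrable_finsetSum _ fun k _ => h j k, rtrace,
    Matrix.trace]
  congr 1
  refine Finset.sum_congr rfl fun j _ => ?_
  rw [integral_finsetSum _ fun k _ => h j k]
  simp_rw [integral_const_mul, integral_star_mul_basis hφ]
  simp

end Orthonormal

/-! ### Measurability of matrix-valued maps -/

section Measurability

variable {T : Type*} [MeasurableSpace T] {X : Type*} [MeasurableSpace X] {n : ℕ}

/-- Entrywise measurability of a matrix-valued function. -/
def EntryMeasurable (A : T → Matrix (Fin n) (Fin n) ℂ) : Prop :=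
  ∀ i j, Measurable fun t => A t i j

theorem EntryMeasurable.det {A : T → Matrix (Fin n) (Fin n) ℂ} (hA : EntryMeasurable A) :
    Measurable fun t => (A t).det := by
  simp_rw [Matrix.det_apply']
  exact Finset.measurable_sum _ fun σ _ =>
    (Finset.measurable_prod _ fun i _ => hA _ _).const_mul _

/-- By Cramer's rule the entries are rational in those of A. The inverse is 0 at singular matrices,
so no invertibility has to be assumed. -/
theorem EntryMeasurable.inv {A : T → Matrix (Fin n) (Fin n) ℂ} (hA : EntryMeasurable A) :
    EntryMeasurable fun t => (A t)⁻¹ := by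
  intro i j
  simp_rw [Matrix.inv_def, Matrix.smul_apply, Ring.inverse_eq_inv', Matrix.adjugate_apply,
    smul_eq_mul]
  refine hA.det.inv.mul (EntryMeasurable.det fun k l => ?_)
  simp_rw [Matrix.updateRow_apply]
  split_ifs
  · exact measurable_const
  · exact hA k l

theorem EntryMeasurable.mul {A B : T → Matrix (Fin n) (Fin n) ℂ} (hA : EntryMeasurable A)
    (hB : EntryMeasurable B) : EntryMeasurable fun t => A t * B t := by
  intro i j
  simp_rw [Matrix.mul_apply]
  exact Finset.measurable_sum _ fun k _ => (hA _ _).mul (hB _ _)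

theorem EntryMeasurable.add {A B : T → Matrix (Fin n) (Fin n) ℂ} (hA : EntryMeasurable A)
    (hB : EntryMeasurable B) : EntryMeasurable fun t => A t + B t :=
  fun i j => (hA i j).add (hB i j)

theorem EntryMeasurable.sub {A B : T → Matrix (Fin n) (Fin n) ℂ} (hA : EntryMeasurable A)
    (hB : EntryMeasurable B) : EntryMeasurable fun t => A t - B t :=
  fun i j => (hA i j).sub (hB i j)

theorem EntryMeasurable.smul {A : T → Matrix (Fin n) (Fin n) ℂ} {c : T → ℝ} (hc : Measurable c)
    (hA : EntryMeasurable A) : EntryMeasurable fun t => (c t : ℂ) • A t :=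
  fun i j => (Complex.measurable_ofReal.comp hc).mul (hA i j)

theorem entryMeasurable_const (M : Matrix (Fin n) (Fin n) ℂ) :
    EntryMeasurable fun _ : T => M := fun _ _ => measurable_const

theorem EntryMeasurable.rtrace {A : T → Matrix (Fin n) (Fin n) ℂ} (hA : EntryMeasurable A) :
    Measurable fun t => rtrace (A t) :=
  Complex.measurable_re.comp (Finset.measurable_sum _ fun i _ => hA i i)

theorem EntryMeasurable.resolvent {A : T → Matrix (Fin n) (Fin n) ℂ} {l : T → ℝ}
    (hA : EntryMeasurable A) (hl : Measurable l) :
    EntryMeasurable fun t => resolvent (A t) (l t) :=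
  (hA.sub ((entryMeasurable_const 1).smul hl)).inv

theorem EntryMeasurable.qform {A : T → Matrix (Fin n) (Fin n) ℂ} (hA : EntryMeasurable A)
    {φ : Fin n → X → ℂ} (hφ : ∀ j, Measurable (φ j)) {x : T → X} (hx : Measurable x) :
    Measurable fun t => qform φ (A t) (x t) := by
  unfold BarrierSampling.qform
  simp_rw [star_dotProduct_mulVec_vec]
  refine Complex.measurable_re.comp (Finset.measurable_sum _ fun j _ =>
    Finset.measurable_sum _ fun k _ => (hA j k).mul (Measurable.mul ?_ ((hφ k).comp hx)))
  exact continuous_star.measurable.comp ((hφ j).comp hx)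

/-- Positive semidefiniteness is a closed condition. This makes the event E measurable. -/
theorem measurableSet_posSemidef {A : T → Matrix (Fin n) (Fin n) ℂ} (hA : EntryMeasurable A) :
    MeasurableSet {t | (A t).PosSemidef} := by
  have hc : IsClosed {M : Fin n → Fin n → ℂ | (Matrix.of M).PosSemidef} := by
    simp_rw [Matrix.posSemidef_iff_dotProduct_mulVec, Set.ofPred_and, Set.ofPred_forall]
    refine IsClosed.inter ?_ (isClosed_iInter fun v => ?_)
    · refine isClosed_eq (f := fun M : Fin n → Fin n → ℂ => (Matrix.of M)ᴴ) ?_ ?_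
      · exact Continuous.matrix_conjTranspose continuous_id
      · exact continuous_id
    · refine isClosed_le continuous_const ?_
      exact Continuous.dotProduct continuous_const
        (Continuous.matrix_mulVec continuous_id continuous_const)
  have hm : Measurable fun t => (fun i j => A t i j : Fin n → Fin n → ℂ) :=
    measurable_pi_lambda _ fun i => measurable_pi_lambda _ fun j => hA i j
  exact hm hc.measurableSet

/-- Measurability of a random state. -/
def MeasurableState (s : T → State n) : Prop :=
  EntryMeasurable (fun t => (s t).A) ∧ Measurable fun t => (s t).barrier

theorem MeasurableState.comp {U : Type*} [MeasurableSpace U] {s : T → State n}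
    (hs : MeasurableState s) {g : U → T} (hg : Measurable g) :
    MeasurableState fun u => s (g u) :=
  ⟨fun i j => (hs.1 i j).comp hg, hs.2.comp hg⟩

end Measurability

/-! ### Sequential sampling: states, invariants and measurability -/

namespace Sampler

universe u

variable {X : Type u} {n : ℕ} {φ : Fin n → X → ℂ} {S : Sampler X n} {m : ℕ}

/-- The state reached from `st` when the point `x` is drawn. -/
def next (φ : Fin n → X → ℂ) (S : Sampler X n) (st : State n) (x : X) : State n :=
  ⟨st.A + (S.weight st x : ℂ) • Matrix.vecMulVec (vec φ x) (star (vec φ x)), S.nextBarrier st⟩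

theorem state_succ (k : ℕ) (h : Fin (k + 1) → X) :
    S.state φ (k + 1) h = S.next φ (S.state φ k (Fin.init h)) (h (Fin.last k)) := rfl

theorem state_snoc (k : ℕ) (h : Fin k → X) (y : X) :
    S.state φ (k + 1) (Fin.snoc (α := fun _ => X) h y) = S.next φ (S.state φ k h) y := by
  rw [state_succ, Fin.init_snoc, Fin.snoc_last]

theorem weights_castSucc (t : Fin (m + 1) → X) (i : Fin m) :
    S.weights φ t i.castSucc = S.weights φ (Fin.init t) i := rfl

theorem weights_last (t : Fin (m + 1) → X) :
    S.weights φ t (Fin.last m) = S.weight (S.state φ m (Fin.init t)) (t (Fin.last m)) := rfl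

/-- Links the recursion to least squares: the form of this sum is the weighted discrete norm of
functions in V. -/
theorem finalMatrix_eq_sum (t : Fin m → X) :
    S.finalMatrix φ t = ∑ i, (S.weights φ t i : ℂ) •
      Matrix.vecMulVec (vec φ (t i)) (star (vec φ (t i))) := by
  induction m with
  | zero => simp [finalMatrix, state, State.init]
  | succ m ih =>
    rw [Fin.sum_univ_castSucc]
    simp_rw [weights_castSucc, weights_last]
    exact congrArg₂ (· + ·) (ih (Fin.init t)) rfl

variable [MeasurableSpace X] {μ : Measure X} {I : State n → Prop}

/-- The rules of the sampler depend measurably on the state and the point. -/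
structure IsMeasurable (S : Sampler X n) : Prop where
  -- Parameter spaces in the universe of X suffice: they are the histories `Fin k → X` and their
  -- products with X.
  nextBarrier : ∀ {T : Type u} [MeasurableSpace T] {s : T → State n}, MeasurableState s →
    Measurable fun t => S.nextBarrier (s t)
  density : ∀ {T : Type u} [MeasurableSpace T] {s : T → State n} {x : T → X},
    MeasurableState s → Measurable x → Measurable fun t => S.density (s t) (x t)
  weight : ∀ {T : Type u} [MeasurableSpace T] {s : T → State n} {x : T → X},
    MeasurableState s → Measurable x → Measurable fun t => S.weight (s t) (x t)

/-- The property `I` of states holds initially and is preserved by drawing points at which the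
density is positive, and the densities are probability densities in states with this property. -/
structure IsInvariant (μ : Measure X) (φ : Fin n → X → ℂ) (S : Sampler X n)
    (I : State n → Prop) : Prop where
  init : I (State.init n)
  next : ∀ st x, I st → 0 < S.density st x → I (S.next φ st x)
  lintegral : ∀ st, I st → ∫⁻ y, ENNReal.ofReal (S.density st y) ∂μ = 1

theorem measurable_take {k : ℕ} (hk : k ≤ m) :
    Measurable (Fin.take k hk : (Fin m → X) → Fin k → X) :=
  measurable_pi_lambda _ fun i => measurable_pi_apply (Fin.castLE hk i)

theorem measurable_init : Measurable (Fin.init : (Fin (m + 1) → X) → Fin m → X) :=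
  measurable_pi_lambda _ fun i => measurable_pi_apply i.castSucc

theorem measurable_snoc :
    Measurable fun p : (Fin m → X) × X => (Fin.snoc (α := fun _ => X) p.1 p.2 : Fin (m + 1) → X) := by
  refine measurable_pi_lambda _ fun i => ?_
  induction i using Fin.lastCases with
  | last => simpa using measurable_snd
  | cast i => simpa using measurable_fst.eval

theorem IsMeasurable.next (hS : S.IsMeasurable) (hφ : ∀ j, Measurable (φ j))
    {T : Type u} [MeasurableSpace T] {s : T → State n} {x : T → X} (hs : MeasurableState s)
    (hx : Measurable x) : MeasurableState fun t => S.next φ (s t) (x t) := by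
  refine ⟨hs.1.add (EntryMeasurable.smul (hS.weight hs hx) fun i j => ?_), hS.nextBarrier hs⟩
  simp only [Matrix.vecMulVec_apply]
  exact ((hφ i).comp hx).mul (continuous_star.measurable.comp ((hφ j).comp hx))

theorem IsMeasurable.state (hS : S.IsMeasurable) (hφ : ∀ j, Measurable (φ j)) (k : ℕ) :
    MeasurableState fun h : Fin k → X => S.state φ k h := by
  induction k with
  | zero => exact ⟨fun _ _ => measurable_const, measurable_const⟩
  | succ k ih => exact hS.next hφ (ih.comp measurable_init) (measurable_pi_apply _)

theorem IsMeasurable.stateBefore (hS : S.IsMeasurable) (hφ : ∀ j, Measurable (φ j)) (i : Fin m) :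
    MeasurableState fun t : Fin m → X => S.stateBefore φ t i :=
  (hS.state hφ i).comp (measurable_take _)

theorem IsMeasurable.weights (hS : S.IsMeasurable) (hφ : ∀ j, Measurable (φ j)) (i : Fin m) :
    Measurable fun t : Fin m → X => S.weights φ t i :=
  hS.weight (hS.stateBefore hφ i) (measurable_pi_apply i)

theorem IsMeasurable.density_state (hS : S.IsMeasurable) (hφ : ∀ j, Measurable (φ j)) (k : ℕ) :
    Measurable fun p : (Fin k → X) × X => ENNReal.ofReal (S.density (S.state φ k p.1) p.2) :=
  (hS.density ((hS.state hφ k).comp measurable_fst) measurable_snd).ennreal_ofReal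

/-- If all points drawn had positive density, then the invariant holds all along. -/
theorem IsInvariant.state (hI : S.IsInvariant μ φ I) (t : Fin m → X)
    (ht : ∀ i, 0 < S.density (S.stateBefore φ t i) (t i)) (k : ℕ) (hk : k ≤ m) :
    I (S.state φ k (Fin.take k hk t)) := by
  induction k with
  | zero => exact hI.init
  | succ k ih =>
    exact hI.next _ _ (ih (Nat.le_of_succ_le hk)) (ht ⟨k, hk⟩)

/-! ### Existence of the random points -/

section Existence

open ProbabilityTheory

/-- The transition density, replaced by `1` where it is not a probability density. -/
def regularDensity (μ : Measure X) (φ : Fin n → X → ℂ) (S : Sampler X n) (k : ℕ)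
    (h : Fin k → X) (y : X) : ℝ≥0∞ :=
  open Classical in
  if ∫⁻ y, ENNReal.ofReal (S.density (S.state φ k h) y) ∂μ = 1 then
    ENNReal.ofReal (S.density (S.state φ k h) y) else 1

theorem measurable_regularDensity [SFinite μ] (hS : S.IsMeasurable) (hφ : ∀ j, Measurable (φ j))
    (k : ℕ) : Measurable (Function.uncurry (S.regularDensity μ φ k)) := by
  have h := hS.density_state hφ k
  refine Measurable.ite ?_ h measurable_const
  exact (h.lintegral_prod_right'.comp measurable_fst) (measurableSet_singleton 1)

theorem lintegral_regularDensity [IsProbabilityMeasure μ] (k : ℕ) (h : Fin k → X) :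
    ∫⁻ y, S.regularDensity μ φ k h y ∂μ = 1 := by
  unfold regularDensity
  split_ifs with h1
  · exact h1
  · simp

/-- The law of m + 1 points is the law of the first m composed with a Markov kernel. Positivity of
the drawn densities is carried through the induction, since it is what keeps the history in `I`,
where the prescribed density has mass 1. -/
theorem exists_isSample [IsProbabilityMeasure μ] (hS : S.IsMeasurable)
    (hφ : ∀ j, Measurable (φ j)) (hI : S.IsInvariant μ φ I) (m : ℕ) :
    ∃ Q : Measure (Fin m → X), IsProbabilityMeasure Q ∧ S.IsSample μ φ Q id ∧
      ∀ᵐ t ∂Q, ∀ i, 0 < S.density (S.stateBefore φ t i) (t i) := by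
  induction m with
  | zero =>
    exact ⟨Measure.dirac Fin.elim0, inferInstance, ⟨measurable_id, fun i => i.elim0⟩,
      Filter.Eventually.of_forall fun _ i => i.elim0⟩
  | succ m ih =>
    obtain ⟨Q, hQ, hQS, hQpos⟩ := ih
    have hd := measurable_regularDensity (μ := μ) hS hφ m
    set κ : Kernel (Fin m → X) X := (Kernel.const _ μ).withDensity (S.regularDensity μ φ m)
      with hκ
    have happ : ∀ h B, κ h B = ∫⁻ y in B, S.regularDensity μ φ m h y ∂μ := fun h B => by
      rw [hκ, Kernel.withDensity_apply' _ hd, Kernel.const_apply]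
    have : IsMarkovKernel κ := ⟨fun h => ⟨by
      rw [happ, Measure.restrict_univ, lintegral_regularDensity]⟩⟩
    -- Replacing bad densities by 1 made κ Markov; it changes nothing for almost every history.
    have hgood : ∀ᵐ h ∂Q, ∀ y, S.regularDensity μ φ m h y =
        ENNReal.ofReal (S.density (S.state φ m h) y) := by
      filter_upwards [hQpos] with h hh y
      exact if_pos (hI.lintegral _ (hI.state h hh m le_rfl))
    set Q' : Measure (Fin (m + 1) → X) :=
      (Q ⊗ₘ κ).map fun p => Fin.snoc (α := fun _ => X) p.1 p.2
    have hQ' : IsProbabilityMeasure Q' :=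
      Measure.isProbabilityMeasure_map measurable_snoc.aemeasurable
    -- The new law extends the old one, so everything known about the first m points transfers.
    have hmap : Q'.map Fin.init = Q := by
      rw [Measure.map_map measurable_init measurable_snoc]
      have : (Fin.init ∘ fun p : (Fin m → X) × X => (Fin.snoc (α := fun _ => X) p.1 p.2 :
          Fin (m + 1) → X)) = Prod.fst := by
        funext p
        exact Fin.init_snoc _ _
      rw [this]
      exact Measure.fst_compProd Q κ
    have hae : ∀ᵐ t ∂Q', ∀ i, 0 < S.density (S.stateBefore φ (Fin.init t) i) (Fin.init t i) := by
      have := hmap ▸ hQpos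
      exact ae_of_ae_map measurable_init.aemeasurable this
    have hlast : ∀ᵐ t ∂Q', 0 < S.density (S.state φ m (Fin.init t)) (t (Fin.last m)) := by
      have hm1 : Measurable fun p : (Fin m → X) × X => S.density (S.state φ m p.1) p.2 :=
        hS.density ((hS.state hφ m).comp measurable_fst) measurable_snd
      have hm2 : Measurable fun t : Fin (m + 1) → X =>
          S.density (S.state φ m (Fin.init t)) (t (Fin.last m)) :=
        hS.density ((hS.state hφ m).comp measurable_init) (measurable_pi_apply _)
      rw [ae_map_iff measurable_snoc.aemeasurable (measurableSet_lt measurable_const hm2)]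
      simp only [Fin.init_snoc, Fin.snoc_last]
      rw [Measure.ae_compProd_iff (measurableSet_lt measurable_const hm1)]
      filter_upwards [hgood] with h hh
      have hdh : Measurable (S.regularDensity μ φ m h) := hd.comp measurable_prodMk_left
      rw [hκ, Kernel.withDensity_apply _ hd, Kernel.const_apply, ae_withDensity_iff hdh]
      refine Filter.Eventually.of_forall fun y hy => ?_
      simp only [hh] at hy
      exact ENNReal.ofReal_pos.1 (pos_iff_ne_zero.2 hy)
    refine ⟨Q', hQ', ⟨measurable_id, ?_⟩, ?_⟩
    · intro i H B hH hB
      induction i using Fin.lastCases with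
      | last =>
        have hm1 : Measurable fun h : Fin m → X =>
            ∫⁻ y in B, ENNReal.ofReal (S.density (S.state φ m h) y) ∂μ :=
          (hS.density_state hφ m).lintegral_prod_right'
        have key : ∀ H : Set (Fin m → X), MeasurableSet H →
            Q' (Fin.init ⁻¹' H ∩ (fun t => t (Fin.last m)) ⁻¹' B) =
              ∫⁻ t in Fin.init ⁻¹' H,
                ∫⁻ y in B, ENNReal.ofReal (S.density (S.state φ m (Fin.init t)) y) ∂μ ∂Q' := by
          intro H hH
          rw [← setLIntegral_map hH hm1 measurable_init, hmap, Measure.map_apply measurable_snoc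
            ((measurable_init hH).inter (measurable_pi_apply _ hB))]
          have e : (fun p : (Fin m → X) × X => (Fin.snoc (α := fun _ => X) p.1 p.2 :
              Fin (m + 1) → X)) ⁻¹' (Fin.init ⁻¹' H ∩ (fun t => t (Fin.last m)) ⁻¹' B) =
              H ×ˢ B := by
            ext p
            simp
          rw [e, Measure.compProd_apply_prod hH hB]
          refine lintegral_congr_ae (ae_restrict_of_ae ?_)
          filter_upwards [hgood] with h hh
          simp_rw [happ, hh]
        exact key H hH
      | cast i =>
        have hm1 : Measurable fun t : Fin m → X =>
            ∫⁻ y in B, ENNReal.ofReal (S.density (S.stateBefore φ t i) y) ∂μ :=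
          ((hS.density_state hφ i).lintegral_prod_right').comp (measurable_take i.isLt.le)
        have hH' : MeasurableSet {t : Fin m → X | Fin.take (i : ℕ) i.isLt.le t ∈ H} :=
          measurable_take _ hH
        have := hQS.2 i H B hH hB
        rw [← hmap] at this
        exact ((Measure.map_apply measurable_init
          (hH'.inter (measurable_pi_apply i hB))).symm.trans this).trans
          (setLIntegral_map hH' hm1 measurable_init)
    · filter_upwards [hae, hlast] with t h1 h2 i
      induction i using Fin.lastCases with
      | last => exact h2
      | cast i => exact h1 i

end Existence

/-! ### Expectations along a sample -/

section Sample

open ProbabilityTheory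

variable {Ω : Type*} [MeasurableSpace Ω] {P : Measure Ω} {x : Ω → Fin m → X}

/-- Expectations of functions of `x_1, …, x_i` are integrals against the density of `x_i`. -/
theorem IsSample.lintegral_eq [IsProbabilityMeasure P] [SFinite μ] (hx : S.IsSample μ φ P x)
    (hS : S.IsMeasurable) (hφ : ∀ j, Measurable (φ j)) (i : Fin m)
    {F : (Fin (i : ℕ) → X) × X → ℝ≥0∞} (hF : Measurable F) :
    ∫⁻ ω, F (Fin.take (i : ℕ) i.isLt.le (x ω), x ω i) ∂P =
      ∫⁻ ω, ∫⁻ y, ENNReal.ofReal (S.density (S.stateBefore φ (x ω) i) y) *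
        F (Fin.take (i : ℕ) i.isLt.le (x ω), y) ∂μ ∂P := by
  have ht : Measurable fun ω => Fin.take (i : ℕ) i.isLt.le (x ω) :=
    (measurable_take i.isLt.le).comp hx.1
  have hxi : Measurable fun ω => x ω i := (measurable_pi_apply i).comp hx.1
  have hd : Measurable (Function.uncurry fun (h : Fin (i : ℕ) → X) (y : X) =>
      ENNReal.ofReal (S.density (S.state φ i h) y)) := hS.density_state hφ i
  set κ : Kernel (Fin (i : ℕ) → X) X := (Kernel.const _ μ).withDensity fun h y =>
    ENNReal.ofReal (S.density (S.state φ i h) y) with hκ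
  -- Only s-finiteness is available for all histories: outside the invariant the density may have
  -- any mass.
  have : IsSFiniteKernel κ := Kernel.IsSFiniteKernel.withDensity _ fun _ _ => ENNReal.ofReal_ne_top
  set Q := P.map fun ω => Fin.take (i : ℕ) i.isLt.le (x ω)
  have hQ : IsProbabilityMeasure Q := Measure.isProbabilityMeasure_map ht.aemeasurable
  have hp : IsProbabilityMeasure (P.map fun ω => (Fin.take (i : ℕ) i.isLt.le (x ω), x ω i)) :=
    Measure.isProbabilityMeasure_map (ht.prodMk hxi).aemeasurable
  -- `IsSample` states this equality on rectangles, and these determine a finite measure on the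
  -- product.
  have hlaw : P.map (fun ω => (Fin.take (i : ℕ) i.isLt.le (x ω), x ω i)) = Q ⊗ₘ κ := by
    refine Measure.ext_prod fun {H B} hH hB => ?_
    rw [Measure.map_apply (ht.prodMk hxi) (hH.prod hB), Measure.compProd_apply_prod hH hB,
      setLIntegral_map hH (κ.measurable_coe hB) ht]
    refine (hx.2 i H B hH hB).trans (lintegral_congr fun ω => ?_)
    rw [hκ, Kernel.withDensity_apply' _ hd, Kernel.const_apply]
    rfl
  rw [← lintegral_map (f := F) hF (ht.prodMk hxi), hlaw, Measure.lintegral_compProd hF,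
    lintegral_map (hF.lintegral_kernel_prod_right') ht]
  refine lintegral_congr fun ω => ?_
  have hFω : Measurable fun y => F (Fin.take (i : ℕ) i.isLt.le (x ω), y) :=
    hF.comp measurable_prodMk_left
  rw [hκ, Kernel.lintegral_withDensity _ hd _ hFω, Kernel.const_apply]
  rfl

/-- A point drawn from a density avoids its zero set: the indicator of {density ≤ 0} times the
truncated density is 0, so its expectation vanishes. -/
theorem IsSample.ae_density_pos [IsProbabilityMeasure P] [SFinite μ] (hx : S.IsSample μ φ P x)
    (hS : S.IsMeasurable) (hφ : ∀ j, Measurable (φ j)) :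
    ∀ᵐ ω ∂P, ∀ i, 0 < S.density (S.stateBefore φ (x ω) i) (x ω i) := by
  refine ae_all_iff.2 fun i => ?_
  have hm : Measurable fun p : (Fin (i : ℕ) → X) × X => S.density (S.state φ i p.1) p.2 :=
    hS.density ((hS.state hφ i).comp measurable_fst) measurable_snd
  have hms : MeasurableSet {p : (Fin (i : ℕ) → X) × X | S.density (S.state φ i p.1) p.2 ≤ 0} :=
    measurableSet_le hm measurable_const
  have h := hx.lintegral_eq hS hφ i
    (F := Set.indicator {p | S.density (S.state φ i p.1) p.2 ≤ 0} 1)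
    (measurable_one.indicator hms)
  have h0 : ∀ ω y, ENNReal.ofReal (S.density (S.stateBefore φ (x ω) i) y) *
      Set.indicator {p : (Fin (i : ℕ) → X) × X | S.density (S.state φ i p.1) p.2 ≤ 0} 1
        (Fin.take (i : ℕ) i.isLt.le (x ω), y) = 0 := by
    intro ω y
    by_cases hy : S.density (S.stateBefore φ (x ω) i) y ≤ 0
    · rw [ENNReal.ofReal_of_nonpos hy, zero_mul]
    · rw [Set.indicator_of_notMem (by exact hy), mul_zero]
  simp_rw [h0, lintegral_zero] at h
  have hm' : Measurable fun ω => Set.indicator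
      {p : (Fin (i : ℕ) → X) × X | S.density (S.state φ i p.1) p.2 ≤ 0} (1 : (Fin (i : ℕ) → X) × X → ℝ≥0∞)
        (Fin.take (i : ℕ) i.isLt.le (x ω), x ω i) :=
    (measurable_one.indicator hms).comp
      (((measurable_take i.isLt.le).comp hx.1).prodMk ((measurable_pi_apply i).comp hx.1))
  rw [lintegral_eq_zero_iff hm'] at h
  filter_upwards [h] with ω hω
  by_contra hc
  rw [Set.indicator_of_mem (by exact not_lt.1 hc)] at hω
  exact one_ne_zero hω

/-- The conditional laws are absolutely continuous with respect to μ. Hence identities between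
versions of functions may be used at the random points. -/
theorem IsSample.ae_mem [IsProbabilityMeasure P] [SFinite μ] (hx : S.IsSample μ φ P x)
    (hS : S.IsMeasurable) (hφ : ∀ j, Measurable (φ j)) {p : X → Prop} (hp : ∀ᵐ y ∂μ, p y) :
    ∀ᵐ ω ∂P, ∀ i, p (x ω i) := by
  refine ae_all_iff.2 fun i => ?_
  set N := toMeasurable μ {y | ¬ p y}
  have hN : MeasurableSet N := measurableSet_toMeasurable _ _
  have hN0 : μ N = 0 := by rw [measure_toMeasurable]; exact hp
  have h := hx.lintegral_eq hS hφ i (F := fun q => Set.indicator N 1 q.2)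
    ((measurable_one.indicator hN).comp measurable_snd)
  have h0 : ∀ ω, ∫⁻ y, ENNReal.ofReal (S.density (S.stateBefore φ (x ω) i) y) *
      Set.indicator N 1 y ∂μ = 0 := by
    intro ω
    have : ∀ᵐ y ∂μ, y ∉ N := measure_eq_zero_iff_ae_notMem.1 hN0
    rw [← lintegral_zero (μ := μ)]
    refine lintegral_congr_ae ?_
    filter_upwards [this] with y hy
    rw [Set.indicator_of_notMem hy, mul_zero]
  simp_rw [h0, lintegral_zero] at h
  have hm' : Measurable fun ω => Set.indicator N (1 : X → ℝ≥0∞) (x ω i) :=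
    (measurable_one.indicator hN).comp ((measurable_pi_apply i).comp hx.1)
  rw [lintegral_eq_zero_iff hm'] at h
  filter_upwards [h] with ω hω
  by_contra hc
  rw [Set.indicator_of_mem (subset_toMeasurable μ _ hc)] at hω
  exact one_ne_zero hω

/-- If the conditional expectation of `Φ` grows by at most `C` in every step, then the expectation
of `Φ` grows at most linearly. -/
theorem IsSample.lintegral_le [IsProbabilityMeasure P] [SFinite μ] (hx : S.IsSample μ φ P x)
    (hS : S.IsMeasurable) (hφ : ∀ j, Measurable (φ j)) (hI : S.IsInvariant μ φ I)
    {Φ : (k : ℕ) → (Fin k → X) → ℝ≥0∞} (hΦ : ∀ k, Measurable (Φ k)) {C : ℝ≥0∞}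
    (hC : ∀ k h, I (S.state φ k h) → ∫⁻ y, ENNReal.ofReal (S.density (S.state φ k h) y) *
      Φ (k + 1) (Fin.snoc (α := fun _ => X) h y) ∂μ ≤ Φ k h + C) (k : ℕ) (hk : k ≤ m) :
    ∫⁻ ω, Φ k (Fin.take k hk (x ω)) ∂P ≤ Φ 0 Fin.elim0 + k * C := by
  induction k with
  | zero =>
    have : ∀ ω, Fin.take 0 hk (x ω) = Fin.elim0 := fun ω => Subsingleton.elim _ _
    simp [this]
  | succ k ih =>
    specialize ih (Nat.le_of_succ_le hk)
    have e : ∀ ω, Fin.take (k + 1) hk (x ω) = Fin.snoc (α := fun _ => X)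
        (Fin.take k (Nat.le_of_succ_le hk) (x ω)) (x ω ⟨k, hk⟩) :=
      fun ω => Fin.take_succ_eq_snoc k hk (x ω)
    simp_rw [e]
    rw [hx.lintegral_eq hS hφ ⟨k, hk⟩
      (F := fun p => Φ (k + 1) (Fin.snoc (α := fun _ => X) p.1 p.2))
      ((hΦ _).comp measurable_snoc)]
    -- The one-step hypothesis is available because almost every history satisfies `I`.
    have hle : ∀ᵐ ω ∂P, ∫⁻ y, ENNReal.ofReal (S.density (S.stateBefore φ (x ω) ⟨k, hk⟩) y) *
        Φ (k + 1) (Fin.snoc (α := fun _ => X) (Fin.take k (Nat.le_of_succ_le hk) (x ω)) y) ∂μ ≤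
        Φ k (Fin.take k (Nat.le_of_succ_le hk) (x ω)) + C := by
      filter_upwards [hx.ae_density_pos hS hφ] with ω hω
      exact hC k _ (hI.state (x ω) hω k (Nat.le_of_succ_le hk))
    refine (lintegral_mono_ae hle).trans ?_
    rw [lintegral_add_right _ measurable_const, lintegral_const, measure_univ, mul_one]
    push_cast
    rw [add_mul, one_mul, ← add_assoc]
    gcongr

end Sample

end Sampler

/-! ### Normal equations -/

section Normal

variable {V E : Type*} [AddCommGroup V] [Module ℂ V] [NormedAddCommGroup E]
  [InnerProductSpace ℂ E] (T : V →ₗ[ℂ] E) (D : E)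

/-- The normal equations of a least squares problem. -/
theorem forall_norm_sub_le_iff_inner (v : V) :
    (∀ u, ‖D - T v‖ ≤ ‖D - T u‖) ↔ ∀ u, inner ℂ (T u) (D - T v) = 0 := by
  have h := (LinearMap.range T).norm_eq_iInf_iff_inner_eq_zero (u := D) (v := T v) ⟨v, rfl⟩
  have hb : BddBelow (Set.range fun w : LinearMap.range T => ‖D - w‖) :=
    ⟨0, by rintro _ ⟨w, rfl⟩; exact norm_nonneg _⟩
  constructor
  · intro hv u
    have : ‖D - T v‖ = ⨅ w : LinearMap.range T, ‖D - w‖ :=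
      le_antisymm (le_ciInf fun ⟨_, u, hu⟩ => hu ▸ hv u) (ciInf_le hb ⟨T v, v, rfl⟩)
    rw [← inner_conj_symm, h.1 this (T u) ⟨u, rfl⟩, map_zero]
  · intro hv u
    rw [h.2]
    · exact ciInf_le hb ⟨T u, u, rfl⟩
    · rintro _ ⟨u, rfl⟩
      rw [← inner_conj_symm, hv u, map_zero]

theorem existsUnique_forall_norm_sub_le [FiniteDimensional ℂ V] (hT : Function.Injective T) :
    ∃! v, ∀ u, ‖D - T v‖ ≤ ‖D - T u‖ := by
  simp_rw [forall_norm_sub_le_iff_inner]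
  obtain ⟨v, hv⟩ : (LinearMap.range T).starProjection D ∈ LinearMap.range T :=
    Submodule.starProjection_apply_mem _ _
  have horth : ∀ u, inner ℂ (T u) (D - T v) = 0 := fun u => by
    rw [hv]
    exact Submodule.inner_right_of_mem_orthogonal (LinearMap.mem_range_self T u)
      (Submodule.sub_starProjection_mem_orthogonal D)
  refine ⟨v, horth, fun v' hv' => hT ?_⟩
  rw [← sub_eq_zero, ← inner_self_eq_zero (𝕜 := ℂ), ← map_sub]
  -- A difference of two residuals, both orthogonal to the range of T, that itself lies in the
  -- range.
  have : T (v' - v) = (D - T v) - (D - T v') := by rw [map_sub]; abel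
  nth_rw 2 [this]
  rw [inner_sub_right, horth, hv', sub_zero]

end Normal

/-! ### Weighted least squares -/

section LeastSquares

variable {X : Type*} [MeasurableSpace X] {μ : Measure X} {n m : ℕ}
  {V : Submodule ℂ (Lp ℂ 2 μ)} (b : OrthonormalBasis (Fin n) ℂ V) (φ : Fin n → X → ℂ)
  (s : Fin m → ℝ) (t : Fin m → X)

theorem evalAt_add (v w : V) (x : X) :
    evalAt b φ (v + w) x = evalAt b φ v x + evalAt b φ w x := by
  simp [evalAt, add_mul, Finset.sum_add_distrib]

theorem evalAt_smul (c : ℂ) (v : V) (x : X) : evalAt b φ (c • v) x = c * evalAt b φ v x := by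
  simp [evalAt, Finset.mul_sum, mul_assoc]

/-- Evaluation at the points `t_i`, scaled by the square roots of the weights. -/
def sampleMap : V →ₗ[ℂ] EuclideanSpace ℂ (Fin m) where
  toFun v := WithLp.toLp 2 fun i => (√(s i) : ℂ) * evalAt b φ v (t i)
  map_add' v w := by
    ext i
    simp [evalAt_add, mul_add]
  map_smul' c v := by
    ext i
    simp only [evalAt_smul, PiLp.smul_apply, smul_eq_mul, RingHom.id_apply]
    ring

/-- The values of `f` at the points `t_i`, scaled by the square roots of the weights. -/
def sampleData (f : X → ℂ) : EuclideanSpace ℂ (Fin m) :=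
  WithLp.toLp 2 fun i => (√(s i) : ℂ) * f (t i)

variable {s}

theorem norm_sq_toLp_sqrt_mul (hs : ∀ i, 0 ≤ s i) (g : Fin m → ℂ) :
    ‖(WithLp.toLp 2 fun i => (√(s i) : ℂ) * g i : EuclideanSpace ℂ (Fin m))‖ ^ 2 =
      ∑ i, s i * ‖g i‖ ^ 2 := by
  rw [EuclideanSpace.norm_sq_eq]
  refine Finset.sum_congr rfl fun i _ => ?_
  simp [mul_pow, Real.sq_sqrt (hs i)]

theorem norm_sq_sampleMap (hs : ∀ i, 0 ≤ s i) (v : V) :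
    ‖sampleMap b φ s t v‖ ^ 2 = ∑ i, s i * ‖evalAt b φ v (t i)‖ ^ 2 :=
  norm_sq_toLp_sqrt_mul hs _

theorem norm_sq_sampleData_sub (hs : ∀ i, 0 ≤ s i) (f : X → ℂ) (v : V) :
    ‖sampleData s t f - sampleMap b φ s t v‖ ^ 2 =
      ∑ i, s i * ‖f (t i) - evalAt b φ v (t i)‖ ^ 2 := by
  rw [← norm_sq_toLp_sqrt_mul hs]
  congr 2
  ext i
  simp [sampleData, sampleMap, mul_sub]

/-- Absorbing √s_i into data and evaluation turns weighted least squares into a nearest-point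
problem in Euclidean space. -/
theorem isLeastSquares_iff (hs : ∀ i, 0 ≤ s i) (f : X → ℂ) (v : V) :
    IsLeastSquares b φ f s t v ↔
      ∀ u, ‖sampleData s t f - sampleMap b φ s t v‖ ≤
        ‖sampleData s t f - sampleMap b φ s t u‖ := by
  refine forall_congr' fun u => ?_
  rw [← norm_sq_sampleData_sub b φ t hs, ← norm_sq_sampleData_sub b φ t hs,
    sq_le_sq₀ (norm_nonneg _) (norm_nonneg _)]

theorem norm_sq_eq_sum_repr (v : V) : ‖v‖ ^ 2 = ∑ j, ‖b.repr v j‖ ^ 2 := by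
  rw [← b.repr.norm_map v, EuclideanSpace.norm_sq_eq]

/-- A lower bound on `A = ∑ s_i φ(t_i) φ(t_i)^*` is a lower bound on the discrete norm. -/
theorem mul_norm_sq_le {A : Matrix (Fin n) (Fin n) ℂ}
    (hA : A = ∑ i, (s i : ℂ) • Matrix.vecMulVec (vec φ (t i)) (star (vec φ (t i)))) {c : ℝ}
    (h : (A - (c : ℂ) • (1 : Matrix (Fin n) (Fin n) ℂ)).PosSemidef) (v : V) :
    c * ‖v‖ ^ 2 ≤ ∑ i, s i * ‖evalAt b φ v (t i)‖ ^ 2 := by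
  -- Coordinates are conjugated so that a^*φ(x) = v(x), and therefore a^*φ(x)φ(x)^*a = |v(x)|².
  set a : Fin n → ℂ := fun j => star (b.repr v j)
  have h0 := h.re_dotProduct_nonneg a
  have h1 : star a ⬝ᵥ ((A - (c : ℂ) • (1 : Matrix (Fin n) (Fin n) ℂ)) *ᵥ a) =
      ((∑ i, s i * ‖evalAt b φ v (t i)‖ ^ 2 - c * ‖v‖ ^ 2 : ℝ) : ℂ) := by
    have e1 : star a ⬝ᵥ a = ((‖v‖ ^ 2 : ℝ) : ℂ) := by
      rw [norm_sq_eq_sum_repr b]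
      simp [a, dotProduct, Complex.mul_conj']
    have e2 : ∀ i, star a ⬝ᵥ vec φ (t i) = evalAt b φ v (t i) := fun i => by
      simp [a, dotProduct, evalAt, vec]
    have e3 : ∀ i, star (vec φ (t i)) ⬝ᵥ a = star (evalAt b φ v (t i)) := fun i => by
      rw [← e2, Matrix.star_dotProduct]
    rw [Matrix.sub_mulVec, dotProduct_sub, Matrix.smul_mulVec, Matrix.one_mulVec,
      dotProduct_smul, e1, hA, Matrix.sum_mulVec, dotProduct_sum]
    push_cast
    congr 1
    refine Finset.sum_congr rfl fun i _ => ?_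
    rw [Matrix.smul_mulVec, dotProduct_smul, Matrix.vecMulVec_mulVec, e3, dotProduct_smul, e2]
    simp [Complex.mul_conj']
  rw [h1] at h0
  have : 0 ≤ ∑ i, s i * ‖evalAt b φ v (t i)‖ ^ 2 - c * ‖v‖ ^ 2 := by exact_mod_cast h0
  linarith

variable {c : ℝ}

/-- The lower bound makes the evaluation map injective. -/
theorem existsUnique_isLeastSquares (hs : ∀ i, 0 ≤ s i) (hc : 0 < c)
    (h : ∀ v : V, c * ‖v‖ ^ 2 ≤ ∑ i, s i * ‖evalAt b φ v (t i)‖ ^ 2) (f : X → ℂ) :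
    ∃! v : V, IsLeastSquares b φ f s t v := by
  have : FiniteDimensional ℂ V := b.toBasis.finiteDimensional_of_finite
  simp_rw [isLeastSquares_iff b φ t hs]
  refine existsUnique_forall_norm_sub_le _ _ ((injective_iff_map_eq_zero _).2 fun v hv => ?_)
  have h1 := h v
  rw [← norm_sq_sampleMap b φ t hs, hv, norm_zero] at h1
  have : ‖v‖ ^ 2 ≤ 0 := by nlinarith
  exact norm_eq_zero.1 (pow_eq_zero_iff two_ne_zero |>.1 (le_antisymm this (sq_nonneg _)))

/-- The normal equations at v tested against v - w. Both stability bounds follow from this identity,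
by Cauchy-Schwarz in the sample space or in the coefficient space. -/
theorem inner_sampleMap_sub_of_isLeastSquares (hs : ∀ i, 0 ≤ s i) {f : X → ℂ} {v : V}
    (hv : IsLeastSquares b φ f s t v) (w : V) :
    inner ℂ (sampleMap b φ s t (v - w)) (sampleData s t f - sampleMap b φ s t w) =
      inner ℂ (sampleMap b φ s t (v - w)) (sampleMap b φ s t (v - w)) := by
  have h := (forall_norm_sub_le_iff_inner _ _ v).1 ((isLeastSquares_iff b φ t hs f v).1 hv) (v - w)
  rw [← sub_eq_zero, ← inner_sub_right, ← h]
  congr 1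
  rw [map_sub]
  abel

/-- The least squares projection is a contraction for the discrete norm. -/
theorem mul_norm_sub_sq_le_sum (hs : ∀ i, 0 ≤ s i)
    (h : ∀ v : V, c * ‖v‖ ^ 2 ≤ ∑ i, s i * ‖evalAt b φ v (t i)‖ ^ 2) {f : X → ℂ} {v : V}
    (hv : IsLeastSquares b φ f s t v) (w : V) :
    c * ‖v - w‖ ^ 2 ≤ ∑ i, s i * ‖f (t i) - evalAt b φ w (t i)‖ ^ 2 := by
  refine (h (v - w)).trans ?_
  rw [← norm_sq_sampleMap b φ t hs, ← norm_sq_sampleData_sub b φ t hs]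
  have h1 := congrArg norm (inner_sampleMap_sub_of_isLeastSquares b φ t hs hv w)
  rw [inner_self_eq_norm_sq_to_K] at h1
  have h2 := norm_inner_le_norm (𝕜 := ℂ) (sampleMap b φ s t (v - w))
    (sampleData s t f - sampleMap b φ s t w)
  rw [h1] at h2
  simp only [norm_pow, Complex.coe_algebraMap, Complex.norm_real, norm_norm] at h2
  set p := ‖sampleMap b φ s t (v - w)‖
  set q := ‖sampleData s t f - sampleMap b φ s t w‖
  have hp : 0 ≤ p := norm_nonneg _
  have hq : 0 ≤ q := norm_nonneg _
  -- From p² ≤ pq with p, q ≥ 0 follows p² ≤ q².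
  nlinarith

/-- A bound on the least squares projection by the residuals of the normal equations. -/
theorem sq_mul_norm_sub_sq_le_sum (hs : ∀ i, 0 ≤ s i) (hc : 0 ≤ c)
    (h : ∀ v : V, c * ‖v‖ ^ 2 ≤ ∑ i, s i * ‖evalAt b φ v (t i)‖ ^ 2) {f : X → ℂ} {v : V}
    (hv : IsLeastSquares b φ f s t v) (w : V) :
    c ^ 2 * ‖v - w‖ ^ 2 ≤
      ∑ j, ‖∑ i, (s i : ℂ) * (star (φ j (t i)) * (f (t i) - evalAt b φ w (t i)))‖ ^ 2 := by
  set u := v - w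
  set ξ : Fin n → ℂ := fun j =>
    ∑ i, (s i : ℂ) * (star (φ j (t i)) * (f (t i) - evalAt b φ w (t i)))
  have h1 := inner_sampleMap_sub_of_isLeastSquares b φ t hs hv w
  -- Summing over basis functions instead of sample points, the inner product pairs the coefficients
  -- of u with the residuals ξ.
  have h2 : inner ℂ (sampleMap b φ s t u) (sampleData s t f - sampleMap b φ s t w) =
      ∑ j, star (b.repr u j) * ξ j := by
    simp only [PiLp.inner_apply, RCLike.inner_apply, ξ, Finset.mul_sum]
    rw [Finset.sum_comm]
    refine Finset.sum_congr (s₁ := (Finset.univ : Finset (Fin m))) rfl fun i _ => ?_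
    have e : ((√(s i) : ℝ) : ℂ) * ((√(s i) : ℝ) : ℂ) = s i := by
      rw [← Complex.ofReal_mul, Real.mul_self_sqrt (hs i)]
    have e' : star (evalAt b φ u (t i)) = ∑ j, star (b.repr u j) * star (φ j (t i)) := by
      simp [evalAt]
    have e'' : ∑ j, star (b.repr u j) *
          ((s i : ℂ) * (star (φ j (t i)) * (f (t i) - evalAt b φ w (t i)))) =
        s i * (f (t i) - evalAt b φ w (t i)) * star (evalAt b φ u (t i)) := by
      rw [e', Finset.mul_sum]
      exact Finset.sum_congr rfl fun j _ => by ring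
    rw [e'', ← e]
    simp only [sampleMap, sampleData, LinearMap.coe_mk, AddHom.coe_mk, PiLp.sub_apply,
      map_mul, Complex.conj_ofReal, Complex.star_def]
    ring
  have h3 : ‖sampleMap b φ s t u‖ ^ 2 ≤ ∑ j, ‖b.repr u j‖ * ‖ξ j‖ := by
    have := congrArg norm (h2.symm.trans h1)
    rw [inner_self_eq_norm_sq_to_K] at this
    simp only [norm_pow, Complex.coe_algebraMap, Complex.norm_real, norm_norm] at this
    rw [← this]
    refine (norm_sum_le _ _).trans_eq ?_
    simp
  have h4 : c * ‖u‖ ^ 2 ≤ ∑ j, ‖b.repr u j‖ * ‖ξ j‖ :=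
    (h u).trans (norm_sq_sampleMap b φ t hs u ▸ h3)
  have h5 := Finset.sum_mul_sq_le_sq_mul_sq Finset.univ (fun j => ‖b.repr u j‖) fun j => ‖ξ j‖
  rw [← norm_sq_eq_sum_repr] at h5
  have h6 : (c * ‖u‖ ^ 2) ^ 2 ≤ ‖u‖ ^ 2 * ∑ j, ‖ξ j‖ ^ 2 :=
    (pow_le_pow_left₀ (by positivity) h4 2).trans h5
  -- A factor ‖u‖² has to be cancelled from `h6`.
  rcases eq_or_lt_of_le (sq_nonneg ‖u‖) with h0 | h0
  · rw [← h0, mul_zero]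
    exact Finset.sum_nonneg fun j _ => sq_nonneg _
  · refine le_of_mul_le_mul_left ?_ h0
    calc ‖u‖ ^ 2 * (c ^ 2 * ‖u‖ ^ 2) = (c * ‖u‖ ^ 2) ^ 2 := by ring
      _ ≤ _ := h6

end LeastSquares

/-! ### Best approximation and Pythagoras -/

section BestApproximation

variable {X : Type*} [MeasurableSpace X] {μ : Measure X} {n : ℕ}
  {V : Submodule ℂ (Lp ℂ 2 μ)} (b : OrthonormalBasis (Fin n) ℂ V) {φ : Fin n → X → ℂ}
  {f : X → ℂ}

theorem evalAt_ae_eq (hφ : ∀ j, φ j =ᵐ[μ] ((b j : Lp ℂ 2 μ) : X → ℂ)) (v : V) :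
    evalAt b φ v =ᵐ[μ] ((v : Lp ℂ 2 μ) : X → ℂ) := by
  have hv : (v : Lp ℂ 2 μ) = ∑ j, b.repr v j • (b j : Lp ℂ 2 μ) := by
    conv_lhs => rw [← b.sum_repr v]
    simp
  have h : ((∑ j, b.repr v j • (b j : Lp ℂ 2 μ) : Lp ℂ 2 μ) : X → ℂ) =ᵐ[μ]
      fun x => ∑ j, b.repr v j * φ j x := by
    have h1 : ∀ᵐ x ∂μ, ∀ j, φ j x = ((b j : Lp ℂ 2 μ) : X → ℂ) x := ae_all_iff.2 hφ
    have h2 : ∀ᵐ x ∂μ, ∀ j, ((b.repr v j • (b j : Lp ℂ 2 μ) : Lp ℂ 2 μ) : X → ℂ) x =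
        b.repr v j * ((b j : Lp ℂ 2 μ) : X → ℂ) x := ae_all_iff.2 fun j => by
      filter_upwards [Lp.coeFn_smul (b.repr v j) (b j : Lp ℂ 2 μ)] with x hx
      rw [hx, Pi.smul_apply, smul_eq_mul]
    filter_upwards [h1, h2, Lp.coeFn_finsetSum Finset.univ
      fun j => b.repr v j • (b j : Lp ℂ 2 μ)] with x h1 h2 h3
    rw [h3, Finset.sum_apply]
    exact Finset.sum_congr rfl fun j _ => by rw [h2, h1]
  rw [hv]
  exact h.symm

theorem errL2_le_add (hf : AEStronglyMeasurable f μ) (v w : V) :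
    errL2 f v ≤ errL2 f w + ENNReal.ofReal ‖v - w‖ := by
  have h1 : ENNReal.ofReal ‖v - w‖ =
      eLpNorm (fun y => ((w : Lp ℂ 2 μ) : X → ℂ) y - ((v : Lp ℂ 2 μ) : X → ℂ) y) 2 μ := by
    rw [norm_sub_rev, Submodule.coe_norm, ofReal_norm, Lp.enorm_def]
    refine eLpNorm_congr_ae ?_
    exact Lp.coeFn_sub _ _
  rw [h1]
  refine le_trans (le_of_eq ?_) (eLpNorm_add_le
    (hf.sub (Lp.aestronglyMeasurable _))
    ((Lp.aestronglyMeasurable (w : Lp ℂ 2 μ)).sub (Lp.aestronglyMeasurable (v : Lp ℂ 2 μ)))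
    one_le_two)
  refine congrArg (fun h => eLpNorm h 2 μ) ?_
  funext y
  simp

/-- The best approximation `w` of `f` in `V`, and a version `g` of the error `f - w`. -/
theorem exists_bestApproximation (hφ : ∀ j, φ j =ᵐ[μ] ((b j : Lp ℂ 2 μ) : X → ℂ))
    (hf : AEStronglyMeasurable f μ) (h : bestError V 2 f ≠ ∞) :
    ∃ (w : V) (g : X → ℂ), Measurable g ∧ MemLp g 2 μ ∧
      (∀ᵐ x ∂μ, f x - evalAt b φ w x = g x) ∧ (∀ j, ∫ x, star (φ j x) * g x ∂μ = 0) ∧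
      ENNReal.ofReal (∫ x, ‖g x‖ ^ 2 ∂μ) = bestError V 2 f ^ 2 ∧
      ∀ v : V, errL2 f v ^ 2 = bestError V 2 f ^ 2 + ENNReal.ofReal (‖v - w‖ ^ 2) := by
  have : FiniteDimensional ℂ V := b.toBasis.finiteDimensional_of_finite
  -- One finite error already forces f into L², since V consists of L² functions.
  obtain ⟨v₀, hv₀⟩ : ∃ v : V, eLpNorm (fun y => f y - ((v : Lp ℂ 2 μ) : X → ℂ) y) 2 μ < ∞ := by
    by_contra! hc
    exact h (by simp only [bestError, top_le_iff.1 (hc _), iInf_const])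
  have hfL : MemLp f 2 μ := by
    have : MemLp (fun y => f y - ((v₀ : Lp ℂ 2 μ) : X → ℂ) y) 2 μ :=
      ⟨hf.sub (Lp.aestronglyMeasurable _), hv₀⟩
    refine (memLp_congr_ae (Filter.Eventually.of_forall fun y => ?_)).1
      (this.add (Lp.memLp (v₀ : Lp ℂ 2 μ)))
    exact sub_add_cancel _ _
  set F : Lp ℂ 2 μ := hfL.toLp f
  have hF : ∀ v : V, ((F - (v : Lp ℂ 2 μ) : Lp ℂ 2 μ) : X → ℂ) =ᵐ[μ]
      fun y => f y - ((v : Lp ℂ 2 μ) : X → ℂ) y := fun v => by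
    filter_upwards [Lp.coeFn_sub F (v : Lp ℂ 2 μ), hfL.coeFn_toLp] with y h1 h2
    rw [h1, Pi.sub_apply, h2]
  have herr : ∀ v : V, errL2 f v = ENNReal.ofReal ‖F - v‖ := fun v => by
    rw [ofReal_norm, Lp.enorm_def, errL2]
    exact eLpNorm_congr_ae (hF v).symm
  set w : V := V.orthogonalProjectionOnto F
  have horth : ∀ v : V, inner ℂ (v : Lp ℂ 2 μ) (F - w) = 0 := fun v =>
    Submodule.inner_right_of_mem_orthogonal v.2 (Submodule.sub_starProjection_mem_orthogonal F)
  have hpyth : ∀ v : V, ‖F - v‖ ^ 2 = ‖F - w‖ ^ 2 + ‖v - w‖ ^ 2 := fun v => by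
    have e : F - (v : Lp ℂ 2 μ) = (F - w) - ((v - w : V) : Lp ℂ 2 μ) := by
      rw [Submodule.coe_sub]; abel
    have := norm_sub_sq (𝕜 := ℂ) (F - (w : Lp ℂ 2 μ)) ((v - w : V) : Lp ℂ 2 μ)
    rw [← inner_conj_symm, horth, map_zero, map_zero, mul_zero, sub_zero, ← e] at this
    exact this
  have hbest : bestError V 2 f = ENNReal.ofReal ‖F - w‖ := by
    refine le_antisymm ((iInf_le _ w).trans_eq (herr w)) (le_iInf fun v => ?_)
    refine le_trans ?_ (herr v).ge
    refine ENNReal.ofReal_le_ofReal ?_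
    have := hpyth v
    exact le_of_sq_le_sq (by nlinarith [sq_nonneg ‖v - w‖]) (norm_nonneg _)
  have hsq : ∀ a : ℝ, 0 ≤ a → ENNReal.ofReal a ^ 2 = ENNReal.ofReal (a ^ 2) :=
    fun a ha => (ENNReal.ofReal_pow ha 2).symm
  -- The representative of the class F - w is measurable everywhere, although f is only almost
  -- everywhere measurable.
  refine ⟨w, ((F - w : Lp ℂ 2 μ) : X → ℂ), (Lp.stronglyMeasurable _).measurable, Lp.memLp _, ?_,
    fun j => ?_, ?_, fun v => ?_⟩
  · filter_upwards [hF w, evalAt_ae_eq b hφ w] with y h1 h2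
    rw [h1, h2]
  · rw [← horth (b j), L2.inner_def]
    refine integral_congr_ae ?_
    filter_upwards [hφ j] with y hy
    rw [hy, RCLike.inner_apply, mul_comm]
    rfl
  · rw [hbest, hsq _ (norm_nonneg _)]
    congr 1
    rw [← inner_self_eq_norm_sq (𝕜 := ℂ), L2.inner_def, ← integral_re]
    · refine integral_congr_ae (Filter.Eventually.of_forall fun y => ?_)
      simp only [inner_self_eq_norm_sq]
    · exact L2.integrable_inner _ _
  · rw [herr, hbest, hsq _ (norm_nonneg _), hsq _ (norm_nonneg _), hpyth,
      ENNReal.ofReal_add (sq_nonneg _) (sq_nonneg _)]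

end BestApproximation

/-- The potential `Tr (A - ℓ I)⁻¹` of a state. -/
def potential {n : ℕ} (st : State n) : ℝ := rtrace (resolvent st.A st.barrier)

/-- Common form of the one-step estimates. A majorant is used because, where the density vanishes,
density times functional is 0 while the formula valid elsewhere may be positive. -/
theorem lintegral_ofReal_mul_le {X : Type*} [MeasurableSpace X] {μ : Measure X} {d F M : X → ℝ}
    (hd : ∀ y, 0 ≤ d y) (hF : ∀ y, 0 ≤ F y) (h : ∀ y, d y * F y ≤ M y) (hM : Integrable M μ) :
    ∫⁻ y, ENNReal.ofReal (d y) * ENNReal.ofReal (F y) ∂μ ≤ ENNReal.ofReal (∫ y, M y ∂μ) := by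
  rw [ofReal_integral_eq_lintegral_ofReal hM
    (Filter.Eventually.of_forall fun y => (mul_nonneg (hd y) (hF y)).trans (h y))]
  refine lintegral_mono fun y => ?_
  rw [← ENNReal.ofReal_mul (hd y)]
  exact ENNReal.ofReal_le_ofReal (h y)

/-- The residuals `∑ s_i conj (φ_j (t_i)) g (t_i)` of the normal equations. -/
def residual {X : Type*} {n : ℕ} (φ : Fin n → X → ℂ) (S : Sampler X n) (g : X → ℂ) {k : ℕ}
    (t : Fin k → X) (j : Fin n) : ℂ :=
  ∑ i, (S.weights φ t i : ℂ) * (star (φ j (t i)) * g (t i))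

theorem residual_snoc {X : Type*} {n : ℕ} (φ : Fin n → X → ℂ) (S : Sampler X n) (g : X → ℂ)
    {k : ℕ} (t : Fin k → X) (y : X) (j : Fin n) :
    residual φ S g (Fin.snoc (α := fun _ => X) t y : Fin (k + 1) → X) j =
      residual φ S g t j + (S.weight (S.state φ k t) y : ℂ) * (star (φ j y) * g y) := by
  rw [residual, Fin.sum_univ_castSucc]
  simp only [Sampler.weights_castSucc, Sampler.weights_last, Fin.init_snoc, Fin.snoc_last,
    Fin.snoc_castSucc]
  rfl

theorem measurable_residual {X : Type*} [MeasurableSpace X] {n : ℕ} {φ : Fin n → X → ℂ}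
    {S : Sampler X n} {g : X → ℂ} (hS : S.IsMeasurable) (hφ : ∀ j, Measurable (φ j))
    (hg : Measurable g) {k : ℕ} (j : Fin n) :
    Measurable fun t : Fin k → X => residual φ S g t j :=
  Finset.measurable_sum _ fun i _ => (Complex.measurable_ofReal.comp (hS.weights hφ i)).mul
    ((continuous_star.measurable.comp ((hφ j).comp (measurable_pi_apply i))).mul
      (hg.comp (measurable_pi_apply i)))

/-! ### Effective resistance: one step -/

section EffectiveResistance

variable {X : Type*} {n : ℕ} {φ : Fin n → X → ℂ} {ε γ : ℝ} {st : State n}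

/-- The increment times Tr Y is ε Tr Y / (Tr Y + γ), which is less than 1. -/
theorem above_erBarrier (hn : 1 ≤ n) (h : Above st.A st.barrier) (hε : ε < 1) (hγ : 0 ≤ γ) :
    Above st.A (erBarrier ε γ st) := by
  refine h.add hn ?_
  have := h.rtrace_pos hn
  rw [div_mul_eq_mul_div, div_lt_one (by positivity)]
  nlinarith

theorem erRho_eq (x : X) :
    erRho φ ε γ st x = qform φ (erZ ε γ st) x + γ / n * qform φ 1 x := by
  rw [erRho, qform_add, qform_smul]

theorem qform_one_nonneg (x : X) : 0 ≤ qform φ 1 x := qform_nonneg φ Matrix.PosSemidef.one x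

theorem resolvent_posDef {A : Matrix (Fin n) (Fin n) ℂ} {l : ℝ} (h : Above A l) :
    (resolvent A l).PosDef := Matrix.PosDef.inv h

theorem erRho_nonneg (h : Above st.A (erBarrier ε γ st)) (hγ : 0 ≤ γ) (x : X) :
    0 ≤ erRho φ ε γ st x := by
  rw [erRho_eq]
  have := qform_nonneg φ (resolvent_posDef h).posSemidef x
  have := qform_one_nonneg (φ := φ) x
  rw [erZ]
  positivity

theorem effectiveResistance_density_nonneg (h : Above st.A (erBarrier ε γ st)) (hγ : 0 ≤ γ)
    (x : X) : 0 ≤ (effectiveResistance φ ε γ).density st x :=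
  div_nonneg (erRho_nonneg h hγ x) (add_nonneg h.rtrace_nonneg hγ)

theorem effectiveResistance_weight_nonneg (h : Above st.A (erBarrier ε γ st)) (hε0 : 0 < ε)
    (hε : ε < 1) (hγ : 0 ≤ γ) (x : X) : 0 ≤ (effectiveResistance φ ε γ).weight st x :=
  div_nonneg (div_nonneg hε0.le (sub_pos.2 hε).le) (erRho_nonneg h hγ x)

theorem effectiveResistance_weight_pos (h : Above st.A (erBarrier ε γ st)) (hε0 : 0 < ε)
    (hε : ε < 1) (hγ : 0 ≤ γ) {x : X} (hx : 0 < (effectiveResistance φ ε γ).density st x) :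
    0 < (effectiveResistance φ ε γ).weight st x := by
  refine div_pos (div_pos hε0 (sub_pos.2 hε)) (lt_of_le_of_ne (erRho_nonneg h hγ x) fun h0 => ?_)
  have : (effectiveResistance φ ε γ).density st x = 0 := by
    simp only [effectiveResistance, ← h0, zero_div]
  exact hx.ne' this

theorem effectiveResistance_next (hn : 1 ≤ n) (h : Above st.A st.barrier) (hε0 : 0 < ε)
    (hε : ε < 1) (hγ : 0 ≤ γ) (x : X) :
    Above ((effectiveResistance φ ε γ).next φ st x).A
      ((effectiveResistance φ ε γ).next φ st x).barrier :=
  have h' := above_erBarrier hn h hε hγ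
  Above.add_rankOne φ h' (effectiveResistance_weight_nonneg h' hε0 hε hγ x) x

variable [MeasurableSpace X] {μ : Measure X} {V : Submodule ℂ (Lp ℂ 2 μ)}
  {b : OrthonormalBasis (Fin n) ℂ V}

theorem effectiveResistance_isMeasurable (hφ : ∀ j, Measurable (φ j)) :
    (effectiveResistance φ ε γ).IsMeasurable := by
  have hb : ∀ {T : Type _} [MeasurableSpace T] {s : T → State n}, MeasurableState s →
      Measurable fun t => erBarrier ε γ (s t) := fun hs =>
    hs.2.add (measurable_const.div ((hs.1.resolvent hs.2).rtrace.add_const _))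
  have hZ : ∀ {T : Type _} [MeasurableSpace T] {s : T → State n}, MeasurableState s →
      EntryMeasurable fun t => erZ ε γ (s t) := fun hs => hs.1.resolvent (hb hs)
  have hρ : ∀ {T : Type _} [MeasurableSpace T] {s : T → State n} {x : T → X},
      MeasurableState s → Measurable x → Measurable fun t => erRho φ ε γ (s t) (x t) :=
    fun hs hx => ((hZ hs).add (entryMeasurable_const _)).qform hφ hx
  exact ⟨hb, fun hs hx => (hρ hs hx).div ((hZ hs).rtrace.add_const _),
    fun hs hx => measurable_const.div (hρ hs hx)⟩

theorem integrable_erRho (hφ : ∀ j, φ j =ᵐ[μ] ((b j : Lp ℂ 2 μ) : X → ℂ)) :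
    Integrable (erRho φ ε γ st) μ := integrable_qform hφ _

theorem integral_effectiveResistance_density (hn : 1 ≤ n)
    (hφ : ∀ j, φ j =ᵐ[μ] ((b j : Lp ℂ 2 μ) : X → ℂ)) (h : Above st.A (erBarrier ε γ st))
    (hγ : 0 ≤ γ) : ∫ y, (effectiveResistance φ ε γ).density st y ∂μ = 1 := by
  have hn' : (n : ℝ) ≠ 0 := by exact_mod_cast (by omega : n ≠ 0)
  have hT : 0 < rtrace (erZ ε γ st) + γ := add_pos_of_pos_of_nonneg (h.rtrace_pos hn) hγ
  have : ∫ y, erRho φ ε γ st y ∂μ = rtrace (erZ ε γ st) + γ := by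
    unfold erRho
    rw [integral_qform hφ, rtrace, Matrix.trace_add, Matrix.trace_smul, Matrix.trace_one,
      Fintype.card_fin, Complex.add_re, smul_eq_mul, ← Complex.ofReal_natCast,
      ← Complex.ofReal_mul, Complex.ofReal_re, div_mul_cancel₀ _ hn']
    rfl
  simp only [effectiveResistance]
  rw [integral_div, this, div_self hT.ne']

theorem effectiveResistance_isInvariant (hn : 1 ≤ n)
    (hφ : ∀ j, φ j =ᵐ[μ] ((b j : Lp ℂ 2 μ) : X → ℂ)) (hε0 : 0 < ε) (hε : ε < 1) (hγ : 0 ≤ γ) :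
    (effectiveResistance φ ε γ).IsInvariant μ φ fun st => Above st.A st.barrier where
  init := above_init hn
  next st x h _ := effectiveResistance_next hn h hε0 hε hγ x
  lintegral st h := by
    have h' := above_erBarrier hn h hε hγ
    have hi : Integrable ((effectiveResistance φ ε γ).density st) μ :=
      (integrable_erRho hφ).div_const _
    rw [← ofReal_integral_eq_lintegral_ofReal hi
      (Filter.Eventually.of_forall (effectiveResistance_density_nonneg h' hγ)),
      integral_effectiveResistance_density hn hφ h' hγ, ENNReal.ofReal_one]

/-- The potential is a supermartingale. -/
theorem lintegral_potential_le (hn : 1 ≤ n)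
    (hφ : ∀ j, φ j =ᵐ[μ] ((b j : Lp ℂ 2 μ) : X → ℂ)) (hε0 : 0 < ε) (hε : ε < 1) (hγ : 0 ≤ γ)
    (h : Above st.A st.barrier) :
    ∫⁻ y, ENNReal.ofReal ((effectiveResistance φ ε γ).density st y) *
      ENNReal.ofReal (potential ((effectiveResistance φ ε γ).next φ st y)) ∂μ ≤
      ENNReal.ofReal (potential st) := by
  have h' := above_erBarrier hn h hε hγ
  have hY := h.rtrace_pos hn
  have hZ := h'.rtrace_pos hn
  set Z := erZ ε γ st with hZdef
  set T := rtrace Z + γ with hT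
  have hT0 : 0 < T := add_pos_of_pos_of_nonneg hZ hγ
  -- The majorant replaces the Sherman-Morrison loss by its lower bound ε φ^*Z²φ / ρ; multiplying by
  -- the density ρ/T cancels ρ.
  have hint : Integrable (fun y => rtrace Z * (erRho φ ε γ st y / T) -
      ε / T * qform φ (Z ^ 2) y) μ :=
    ((integrable_erRho hφ).div_const _).const_mul _ |>.sub ((integrable_qform hφ _).const_mul _)
  refine (lintegral_ofReal_mul_le (effectiveResistance_density_nonneg h' hγ)
    (fun y => (effectiveResistance_next hn h hε0 hε hγ y).rtrace_nonneg) (fun y => ?_)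
    hint).trans (ENNReal.ofReal_le_ofReal ?_)
  · have hs := effectiveResistance_weight_nonneg (φ := φ) h' hε0 hε hγ y
    have e : potential ((effectiveResistance φ ε γ).next φ st y) = _ :=
      rtrace_resolvent_add_rankOne φ h' hs y
    refine (congrArg (_ * ·) e).trans_le ?_
    have hρ : 0 ≤ erRho φ ε γ st y := erRho_nonneg h' hγ y
    have hq := qform_nonneg φ (resolvent_posDef h').posSemidef y
    have hq2 := qform_nonneg φ ((resolvent_posDef h').posSemidef.pow 2) y
    have hle : qform φ (resolvent st.A (erBarrier ε γ st)) y ≤ erRho φ ε γ st y := by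
      rw [erRho_eq]
      have := qform_one_nonneg (φ := φ) y
      have : 0 ≤ γ / n * qform φ 1 y := by positivity
      rw [erZ]
      linarith
    change erRho φ ε γ st y / T * (rtrace Z - (ε / (1 - ε)) / erRho φ ε γ st y * qform φ (Z ^ 2) y /
      (1 + (ε / (1 - ε)) / erRho φ ε γ st y * qform φ Z y)) ≤ _
    change 0 ≤ qform φ Z y at hq
    change 0 ≤ qform φ (Z ^ 2) y at hq2
    change qform φ Z y ≤ _ at hle
    have hε' : 0 < 1 - ε := sub_pos.2 hε
    -- If ρ = 0 then φ^*Zφ = 0, so Zφ = 0 and the Z² term of the majorant vanishes too.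
    rcases hρ.eq_or_lt with h0 | h0
    · rw [← h0]
      have hz : qform φ Z y = 0 := le_antisymm (h0 ▸ hle) hq
      have hv : Z *ᵥ vec φ y = 0 := by
        have := (resolvent_posDef h').posSemidef.dotProduct_mulVec_zero_iff (vec φ y)
        refine this.1 ?_
        rw [← ofReal_qform φ (resolvent_posDef h').isHermitian]
        exact_mod_cast hz
      have hz2 : qform φ (Z ^ 2) y = 0 := by
        rw [qform, sq, ← Matrix.mulVec_mulVec, hv, Matrix.mulVec_zero, dotProduct_zero,
          Complex.zero_re]
      rw [hz2]
      simp
    · set ρ := erRho φ ε γ st y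
      set q := qform φ Z y
      set p := qform φ (Z ^ 2) y
      -- This is where η = ε/(1 - ε) comes from: φ^*Zφ ≤ ρ bounds the denominator by 1 + η, and η/(1
      -- + η) = ε.
      have key : ε * p / ρ ≤ ε / (1 - ε) / ρ * p / (1 + ε / (1 - ε) / ρ * q) := by
        have hd : 0 < 1 + ε / (1 - ε) / ρ * q := by positivity
        rw [le_div_iff₀ hd]
        have h1 : ε / (1 - ε) / ρ * q ≤ ε / (1 - ε) := by
          rw [div_mul_eq_mul_div, div_le_iff₀ h0]
          gcongr
        calc ε * p / ρ * (1 + ε / (1 - ε) / ρ * q) ≤ ε * p / ρ * (1 + ε / (1 - ε)) := by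
              gcongr
          _ = ε / (1 - ε) / ρ * p := by field_simp; ring
      calc ρ / T * (rtrace Z - ε / (1 - ε) / ρ * p / (1 + ε / (1 - ε) / ρ * q))
          ≤ ρ / T * (rtrace Z - ε * p / ρ) := by gcongr
        _ = rtrace Z * (ρ / T) - ε / T * p := by field_simp
  · rw [integral_sub (((integrable_erRho hφ).div_const _).const_mul _)
      ((integrable_qform hφ _).const_mul _), integral_const_mul, integral_const_mul,
      integral_qform hφ]
    have e1 : ∫ y, erRho φ ε γ st y / T ∂μ = 1 :=
      integral_effectiveResistance_density hn hφ h' hγ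
    rw [e1, mul_one]
    have hpos : 0 < rtrace (resolvent st.A st.barrier) + γ := by positivity
    -- The increment satisfies δ(Tr Y + γ) = ε, so the mean loss ε Tr Z² / T covers the rise Tr Z -
    -- Tr Y.
    have key := rtrace_sub_mul_le h h' (div_pos hε0 hpos).le hγ
    change (rtrace Z - _) * T ≤ _ * rtrace (Z ^ 2) at key
    rw [div_mul_cancel₀ _ hpos.ne'] at key
    have : rtrace Z - potential st ≤ ε / T * rtrace (Z ^ 2) := by
      rw [div_mul_eq_mul_div, le_div_iff₀ hT0]
      exact key
    linarith

/-- The expected squared residual grows at most linearly. -/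
theorem lintegral_residual_le (hn : 1 ≤ n)
    (hφ : ∀ j, φ j =ᵐ[μ] ((b j : Lp ℂ 2 μ) : X → ℂ)) (hε0 : 0 < ε) (hε : ε < 1) (hγ : 0 < γ)
    {g : X → ℂ} (hg : MemLp g 2 μ) (hort : ∀ j, ∫ x, star (φ j x) * g x ∂μ = 0)
    (h : Above st.A st.barrier) (a : Fin n → ℂ) :
    ∫⁻ y, ENNReal.ofReal ((effectiveResistance φ ε γ).density st y) *
      ENNReal.ofReal (∑ j, ‖a j + ((effectiveResistance φ ε γ).weight st y : ℂ) *
        (star (φ j y) * g y)‖ ^ 2) ∂μ ≤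
      ENNReal.ofReal (∑ j, ‖a j‖ ^ 2) +
        ENNReal.ofReal ((ε / (1 - ε)) ^ 2 * n / γ ^ 2 * ∫ x, ‖g x‖ ^ 2 ∂μ) := by
  have h' := above_erBarrier hn h hε hγ.le
  have hn' : (0 : ℝ) < n := by exact_mod_cast hn
  set T := rtrace (erZ ε γ st) + γ with hT
  have hTγ : γ ≤ T := le_add_of_nonneg_left h'.rtrace_nonneg
  have hT0 : 0 < T := hγ.trans_le hTγ
  set η := ε / (1 - ε)
  have hη : 0 < η := div_pos hε0 (sub_pos.2 hε)
  have hg2 : Integrable (fun x => ‖g x‖ ^ 2) μ := hg.integrable_norm_pow two_ne_zero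
  have hu : ∀ j, Integrable (fun y => star (a j) * (star (φ j y) * g y)) μ := fun j =>
    (integrable_star_mul_of_memLp (memLp_of_ae_eq_basis hφ j) hg).const_mul _
  have hd : Integrable (fun y => erRho φ ε γ st y / T) μ := (integrable_erRho hφ).div_const _
  have hu' : Integrable (fun y => (∑ j, star (a j) * (star (φ j y) * g y)).re) μ :=
    (integrable_finsetSum _ fun j _ => hu j).re
  -- The cross term has mean zero because g is orthogonal to V.
  have hi0 : ∫ y, (∑ j, star (a j) * (star (φ j y) * g y)).re ∂μ = 0 := by
    have e := integral_re (integrable_finsetSum Finset.univ fun j _ => hu j)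
    simp only [RCLike.re_to_complex] at e
    rw [e, integral_finsetSum _ fun j _ => hu j]
    simp_rw [integral_const_mul, hort]
    simp
  rw [← ENNReal.ofReal_add (Finset.sum_nonneg fun _ _ => sq_nonneg _) (mul_nonneg (by positivity)
    (integral_nonneg fun _ => sq_nonneg _))]
  -- Expanding the square gives three terms. Where ρ > 0, density times weight is the constant η/T,
  -- which makes the cross term linear in conj(φ)g.
  have hM : Integrable (fun y => (∑ j, ‖a j‖ ^ 2) * (erRho φ ε γ st y / T) +
      2 * (η / T) * (∑ j, star (a j) * (star (φ j y) * g y)).re +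
      η ^ 2 * n / γ ^ 2 * ‖g y‖ ^ 2) μ :=
    ((hd.const_mul _).add (hu'.const_mul _)).add (hg2.const_mul _)
  refine (lintegral_ofReal_mul_le (effectiveResistance_density_nonneg h' hγ.le)
    (fun y => Finset.sum_nonneg fun _ _ => sq_nonneg _) (fun y => ?_)
    hM).trans_eq (congrArg _ ?_)
  · have hρ := erRho_nonneg (φ := φ) h' hγ.le y
    have hq := qform_nonneg φ (resolvent_posDef h').posSemidef y
    have hle : γ / n * ∑ j, ‖φ j y‖ ^ 2 ≤ erRho φ ε γ st y := by
      rw [erRho_eq, qform_one]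
      exact le_add_of_nonneg_left hq
    change erRho φ ε γ st y / T *
      ∑ j, ‖a j + ((η / erRho φ ε γ st y : ℝ) : ℂ) * (star (φ j y) * g y)‖ ^ 2 ≤ _
    set ρ := erRho φ ε γ st y
    have hexp : ∀ j, ‖a j + ((η / ρ : ℝ) : ℂ) * (star (φ j y) * g y)‖ ^ 2 =
        ‖a j‖ ^ 2 + 2 * (η / ρ) * (star (a j) * (star (φ j y) * g y)).re +
          (η / ρ) ^ 2 * (‖φ j y‖ ^ 2 * ‖g y‖ ^ 2) := fun j => by
      rw [← mul_pow, ← norm_star (φ j y), ← norm_mul]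
      generalize star (φ j y) * g y = u
      simp only [Complex.sq_norm, Complex.normSq_apply, Complex.star_def, Complex.add_re,
        Complex.add_im, Complex.mul_re, Complex.mul_im, Complex.ofReal_re, Complex.ofReal_im,
        Complex.conj_re, Complex.conj_im]
      ring
    simp_rw [hexp, Finset.sum_add_distrib, ← Finset.mul_sum, ← Finset.sum_mul, ← Complex.re_sum]
    set N := ∑ j, ‖φ j y‖ ^ 2
    have hN : 0 ≤ N := Finset.sum_nonneg fun _ _ => sq_nonneg _
    -- Since γ > 0, ρ = 0 forces φ(y) = 0 and the cross term disappears.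
    rcases hρ.eq_or_lt with h0 | h0
    · have hN0 : N = 0 := by
        have : 0 < γ / n := by positivity
        nlinarith
      have hφ0 : ∀ j, φ j y = 0 := fun j => by
        have := (Finset.sum_eq_zero_iff_of_nonneg fun _ _ => sq_nonneg _).1 hN0 j
          (Finset.mem_univ j)
        exact norm_eq_zero.1 (pow_eq_zero_iff two_ne_zero |>.1 this)
      rw [← h0]
      simp only [hφ0, star_zero, zero_mul, mul_zero, Finset.sum_const_zero, Complex.zero_re,
        zero_div, zero_add]
      positivity
    · set G := ‖g y‖ ^ 2
      have hG : 0 ≤ G := sq_nonneg _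
      set A := ∑ j, ‖a j‖ ^ 2
      set R := (∑ j, star (a j) * (star (φ j y) * g y)).re
      have e : ρ / T * (A + 2 * (η / ρ) * R + (η / ρ) ^ 2 * (N * G)) =
          A * (ρ / T) + 2 * (η / T) * R + η ^ 2 / T * (N / ρ) * G := by
        field_simp
      rw [e]
      -- The summand γI/n in ρ serves this purpose: it bounds |φ|²/ρ uniformly. A second factor 1/γ
      -- comes from T ≥ γ.
      have h1 : N / ρ ≤ n / γ := by
        rw [div_le_div_iff₀ h0 hγ]
        have : γ / n * N * n = N * γ := by field_simp
        nlinarith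
      have h2 : η ^ 2 / T * (N / ρ) ≤ η ^ 2 / γ * (n / γ) := by gcongr
      have h3 : η ^ 2 / γ * (n / γ) = η ^ 2 * n / γ ^ 2 := by field_simp
      rw [← h3]
      gcongr
  · have e1 : ∫ y, erRho φ ε γ st y / T ∂μ = 1 :=
      integral_effectiveResistance_density hn hφ h' hγ.le
    have hadd : Integrable (fun y => (∑ j, ‖a j‖ ^ 2) * (erRho φ ε γ st y / T) +
        2 * (η / T) * (∑ j, star (a j) * (star (φ j y) * g y)).re) μ :=
      (hd.const_mul _).add (hu'.const_mul _)
    rw [integral_add hadd (hg2.const_mul _),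
      integral_add (hd.const_mul _) (hu'.const_mul _), integral_const_mul, integral_const_mul,
      integral_const_mul, hi0, e1]
    ring

end EffectiveResistance

/-! ### Fixed increments: one step -/

section FixedIncrements

variable {X : Type*} {n : ℕ} {φ : Fin n → X → ℂ} {δ κ : ℝ} {st : State n}

/-- The invariant of sampling with fixed increments. -/
def UnitPotential {n : ℕ} (st : State n) : Prop := Above st.A st.barrier ∧ potential st = 1

theorem UnitPotential.above_add (hn : 1 ≤ n) (h : UnitPotential st) (hδ : δ < 1) :
    Above st.A (st.barrier + δ) := by
  refine h.1.add hn ?_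
  have : rtrace (resolvent st.A st.barrier) = 1 := h.2
  rwa [this, mul_one]

/-- The increase of the trace of the resolvent when the barrier moves by `δ`. -/
def traceIncrement {n : ℕ} (δ : ℝ) (st : State n) : ℝ :=
  rtrace (resolvent st.A (st.barrier + δ)) - potential st

theorem UnitPotential.traceIncrement_pos (hn : 1 ≤ n) (h : UnitPotential st) (hδ0 : 0 < δ)
    (hδ : δ < 1) : 0 < traceIncrement δ st :=
  sub_pos.2 (rtrace_lt_rtrace_add hn h.1 (h.above_add hn hδ) hδ0)

theorem qform_fiW (x : X) :
    qform φ (fiW δ st) x = (traceIncrement δ st)⁻¹ *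
      qform φ (resolvent st.A (st.barrier + δ) ^ 2) x -
        qform φ (resolvent st.A (st.barrier + δ)) x := by
  rw [fiW, qform_sub, qform_smul]
  rfl

/-- With Tr Y = 1 and γ = 0 the trace comparison gives Tr W ≥ (1/δ - 1) Tr Z, and Tr Z > 1. -/
theorem UnitPotential.lt_rtrace_fiW (hn : 1 ≤ n) (h : UnitPotential st) (hδ0 : 0 < δ)
    (hδ : δ < 1) : (1 - δ) / δ < rtrace (fiW δ st) := by
  have h' := h.above_add hn hδ
  have hD := h.traceIncrement_pos hn hδ0 hδ
  have hY : rtrace (resolvent st.A st.barrier) = 1 := h.2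
  have key := rtrace_sub_mul_le h.1 h' hδ0.le (le_refl (0 : ℝ))
  change traceIncrement δ st * _ ≤ _ at key
  rw [hY, add_zero, add_zero, mul_one] at key
  have hZ : 1 < rtrace (resolvent st.A (st.barrier + δ)) := by
    have := hD
    rw [traceIncrement, h.2] at this
    linarith
  have e : rtrace (fiW δ st) = (traceIncrement δ st)⁻¹ *
      rtrace (resolvent st.A (st.barrier + δ) ^ 2) - rtrace (resolvent st.A (st.barrier + δ)) := by
    rw [fiW, rtrace, Matrix.trace_sub, Matrix.trace_smul, Complex.sub_re, smul_eq_mul,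
      Complex.re_ofReal_mul]
    rfl
  rw [e]
  set z := rtrace (resolvent st.A (st.barrier + δ))
  set q := rtrace (resolvent st.A (st.barrier + δ) ^ 2)
  have h1 : z / δ ≤ (traceIncrement δ st)⁻¹ * q := by
    rw [inv_mul_eq_div, div_le_div_iff₀ hδ0 hD]
    linarith
  have h2 : (1 - δ) / δ < z * ((1 - δ) / δ) := by
    have : 0 < (1 - δ) / δ := div_pos (sub_pos.2 hδ) hδ0
    nlinarith
  have h3 : z * ((1 - δ) / δ) = z / δ - z := by field_simp
  linarith

theorem threshold_nonneg (hδ0 : 0 < δ) (hδ : δ < 1) (hκ : 0 ≤ κ) : 0 ≤ κ * ((1 - δ) / δ) :=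
  mul_nonneg hκ (div_nonneg (sub_pos.2 hδ).le hδ0.le)

theorem fiR_nonneg (hδ0 : 0 < δ) (hδ : δ < 1) (hκ : 0 ≤ κ) (x : X) : 0 ≤ fiR φ δ κ st x := by
  rw [fiR]
  split_ifs with h
  · exact (threshold_nonneg hδ0 hδ hκ).trans h
  · exact le_rfl

theorem threshold_le_fiR {x : X} (hx : 0 < fiR φ δ κ st x) :
    κ * ((1 - δ) / δ) ≤ fiR φ δ κ st x := by
  rw [fiR] at hx ⊢
  split_ifs at hx ⊢ with h
  · exact h
  · exact absurd hx (lt_irrefl _)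

theorem fiR_eq_of_pos {x : X} (hx : 0 < fiR φ δ κ st x) :
    fiR φ δ κ st x = qform φ (fiW δ st) x := by
  rw [fiR] at hx ⊢
  split_ifs at hx ⊢ with h
  · rfl
  · exact absurd hx (lt_irrefl _)

variable [MeasurableSpace X] {μ : Measure X} {V : Submodule ℂ (Lp ℂ 2 μ)}
  {b : OrthonormalBasis (Fin n) ℂ V}

theorem measurable_fiR (hφm : ∀ j, Measurable (φ j)) {T : Type*} [MeasurableSpace T]
    {s : T → State n} {x : T → X} (hs : MeasurableState s) (hx : Measurable x) :
    Measurable fun t => fiR φ δ κ (s t) (x t) := by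
  have hZ : EntryMeasurable fun t => resolvent (s t).A ((s t).barrier + δ) :=
    hs.1.resolvent (hs.2.add_const δ)
  have hY : EntryMeasurable fun t => resolvent (s t).A (s t).barrier := hs.1.resolvent hs.2
  have hW : EntryMeasurable fun t => fiW δ (s t) := by
    simp only [fiW, sq]
    exact ((hZ.mul hZ).smul (hZ.rtrace.sub hY.rtrace).inv).sub hZ
  have hw := hW.qform hφm hx
  exact Measurable.ite (measurableSet_le measurable_const hw) hw measurable_const

theorem fixedIncrements_isMeasurable [SFinite μ] (hφm : ∀ j, Measurable (φ j)) :
    (fixedIncrements φ δ κ μ).IsMeasurable where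
  nextBarrier hs := hs.2.add_const δ
  density {T _ s x} hs hx := by
    refine (measurable_fiR hφm hs hx).div ?_
    have : StronglyMeasurable fun p : T × X => fiR φ δ κ (s p.1) p.2 :=
      (measurable_fiR hφm (hs.comp measurable_fst) measurable_snd).stronglyMeasurable
    exact this.integral_prod_right'.measurable
  weight hs hx := measurable_const.div (measurable_fiR hφm hs hx)

theorem integrable_fiR (hφm : ∀ j, Measurable (φ j))
    (hφ : ∀ j, φ j =ᵐ[μ] ((b j : Lp ℂ 2 μ) : X → ℂ)) : Integrable (fiR φ δ κ st) μ := by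
  refine (integrable_qform hφ (fiW δ st)).mono
    (measurable_fiR hφm (s := fun _ => st) ⟨entryMeasurable_const _, measurable_const⟩
      measurable_id).aestronglyMeasurable (Filter.Eventually.of_forall fun x => ?_)
  rw [fiR]
  split_ifs
  · exact le_rfl
  · simp

/-- Truncation lowers w by at most the threshold at each point, and μ has mass 1; discarding
negative values only helps. -/
theorem UnitPotential.lt_integral_fiR [IsProbabilityMeasure μ] (hn : 1 ≤ n)
    (hφm : ∀ j, Measurable (φ j)) (hφ : ∀ j, φ j =ᵐ[μ] ((b j : Lp ℂ 2 μ) : X → ℂ))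
    (h : UnitPotential st) (hδ0 : 0 < δ) (hδ : δ < 1) (hκ : 0 ≤ κ) :
    (1 - κ) * ((1 - δ) / δ) < ∫ y, fiR φ δ κ st y ∂μ := by
  have hR := integrable_fiR (δ := δ) (κ := κ) (st := st) hφm hφ
  have h1 : rtrace (fiW δ st) ≤ ∫ y, (fiR φ δ κ st y + κ * ((1 - δ) / δ)) ∂μ := by
    rw [← integral_qform hφ]
    refine integral_mono (integrable_qform hφ _) (hR.add (integrable_const _)) fun y => ?_
    simp only [fiR]
    split_ifs with hy
    · exact le_add_of_nonneg_right (threshold_nonneg hδ0 hδ hκ)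
    · rw [zero_add]
      exact (not_le.1 hy).le
  rw [integral_add hR (integrable_const _), integral_const, probReal_univ, one_smul] at h1
  have := h.lt_rtrace_fiW hn hδ0 hδ
  linarith

/-- Strictness of the trace bound matters at κ = 1, where the lower bound itself is 0. -/
theorem UnitPotential.integral_fiR_pos [IsProbabilityMeasure μ] (hn : 1 ≤ n)
    (hφm : ∀ j, Measurable (φ j)) (hφ : ∀ j, φ j =ᵐ[μ] ((b j : Lp ℂ 2 μ) : X → ℂ))
    (h : UnitPotential st) (hδ0 : 0 < δ) (hδ : δ < 1) (hκ : 0 ≤ κ) (hκ1 : κ ≤ 1) :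
    0 < ∫ y, fiR φ δ κ st y ∂μ :=
  (mul_nonneg (sub_nonneg.2 hκ1) (div_nonneg (sub_pos.2 hδ).le hδ0.le)).trans_lt
    (h.lt_integral_fiR hn hφm hφ hδ0 hδ hκ)

theorem fixedIncrements_density_nonneg (hδ0 : 0 < δ) (hδ : δ < 1) (hκ : 0 ≤ κ) (x : X) :
    0 ≤ (fixedIncrements φ δ κ μ).density st x :=
  div_nonneg (fiR_nonneg hδ0 hδ hκ x) (integral_nonneg fun y => fiR_nonneg hδ0 hδ hκ y)

theorem fixedIncrements_weight_nonneg (hδ0 : 0 < δ) (hδ : δ < 1) (hκ : 0 ≤ κ) (x : X) :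
    0 ≤ (fixedIncrements φ δ κ μ).weight st x :=
  div_nonneg zero_le_one (fiR_nonneg hδ0 hδ hκ x)

theorem fiR_pos_of_density_pos (hδ0 : 0 < δ) (hδ : δ < 1) (hκ : 0 ≤ κ) {x : X}
    (hx : 0 < (fixedIncrements φ δ κ μ).density st x) : 0 < fiR φ δ κ st x := by
  refine lt_of_le_of_ne (fiR_nonneg hδ0 hδ hκ x) fun h0 => hx.ne' ?_
  simp only [fixedIncrements, ← h0, zero_div]

theorem fixedIncrements_weight_pos (hδ0 : 0 < δ) (hδ : δ < 1) (hκ : 0 ≤ κ) {x : X}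
    (hx : 0 < (fixedIncrements φ δ κ μ).density st x) :
    0 < (fixedIncrements φ δ κ μ).weight st x :=
  div_pos one_pos (fiR_pos_of_density_pos hδ0 hδ hκ hx)

theorem fixedIncrements_weight_le (hδ0 : 0 < δ) (hδ : δ < 1) (hκ : 0 < κ) {x : X}
    (hx : 0 < (fixedIncrements φ δ κ μ).density st x) :
    (fixedIncrements φ δ κ μ).weight st x ≤ 1 / (κ * ((1 - δ) / δ)) :=
  one_div_le_one_div_of_le (mul_pos hκ (div_pos (sub_pos.2 hδ) hδ0))
    (threshold_le_fiR (fiR_pos_of_density_pos hδ0 hδ hκ.le hx))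

/-- The equation s p / (1 + s q) = D, loss equal to gain, has the solution 1/s = p/D - q, which is
w. Positive density is needed: otherwise the weight is 1/0 = 0 and the gain is not compensated. -/
theorem UnitPotential.next (hn : 1 ≤ n) (h : UnitPotential st) (hδ0 : 0 < δ) (hδ : δ < 1)
    (hκ : 0 ≤ κ) {x : X} (hx : 0 < (fixedIncrements φ δ κ μ).density st x) :
    UnitPotential ((fixedIncrements φ δ κ μ).next φ st x) := by
  have h' := h.above_add hn hδ
  have hs := fixedIncrements_weight_nonneg (φ := φ) (μ := μ) (st := st) hδ0 hδ hκ x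
  refine ⟨Above.add_rankOne φ h' hs x, ?_⟩
  refine (rtrace_resolvent_add_rankOne φ h' hs x).trans ?_
  have hR := fiR_pos_of_density_pos hδ0 hδ hκ hx
  have hD := h.traceIncrement_pos hn hδ0 hδ
  have hq := qform_nonneg φ (resolvent_posDef h').posSemidef x
  have e := (fiR_eq_of_pos hR).trans (qform_fiW x)
  have hz : rtrace (resolvent st.A (st.barrier + δ)) = 1 + traceIncrement δ st := by
    rw [traceIncrement, h.2]
    ring
  set q := qform φ (resolvent st.A (st.barrier + δ)) x with hqdef
  set p := qform φ (resolvent st.A (st.barrier + δ) ^ 2) x with hpdef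
  change rtrace (resolvent st.A (st.barrier + δ)) -
    1 / fiR φ δ κ st x * p / (1 + 1 / fiR φ δ κ st x * q) = 1
  rw [hz]
  set D := traceIncrement δ st
  set R := fiR φ δ κ st x
  have hp : p = D * (R + q) := by
    rw [e]
    field_simp
    ring
  have hRq : R + q ≠ 0 := (add_pos_of_pos_of_nonneg hR hq).ne'
  rw [hp]
  field_simp
  ring

theorem fixedIncrements_isInvariant [IsProbabilityMeasure μ] (hn : 1 ≤ n)
    (hφm : ∀ j, Measurable (φ j)) (hφ : ∀ j, φ j =ᵐ[μ] ((b j : Lp ℂ 2 μ) : X → ℂ))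
    (hδ0 : 0 < δ) (hδ : δ < 1) (hκ : 0 ≤ κ) (hκ1 : κ ≤ 1) :
    (fixedIncrements φ δ κ μ).IsInvariant μ φ UnitPotential where
  init := ⟨above_init hn, rtrace_resolvent_init hn⟩
  next st x h hx := h.next hn hδ0 hδ hκ hx
  lintegral st h := by
    have hi : Integrable ((fixedIncrements φ δ κ μ).density st) μ :=
      (integrable_fiR hφm hφ).div_const _
    rw [← ofReal_integral_eq_lintegral_ofReal hi
      (Filter.Eventually.of_forall (fixedIncrements_density_nonneg hδ0 hδ hκ))]
    have : ∫ y, (fixedIncrements φ δ κ μ).density st y ∂μ = 1 := by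
      simp only [fixedIncrements]
      rw [integral_div, div_self (h.integral_fiR_pos hn hφm hφ hδ0 hδ hκ hκ1).ne']
    rw [this, ENNReal.ofReal_one]

/-- The expected discrete norm grows at most linearly. -/
theorem UnitPotential.lintegral_weight_mul_le [IsProbabilityMeasure μ] (hn : 1 ≤ n)
    (hφm : ∀ j, Measurable (φ j)) (hφ : ∀ j, φ j =ᵐ[μ] ((b j : Lp ℂ 2 μ) : X → ℂ))
    (h : UnitPotential st) (hδ0 : 0 < δ) (hδ : δ < 1) (hκ : 0 ≤ κ) (hκ1 : κ < 1)
    {g : X → ℂ} (hg : MemLp g 2 μ) {a : ℝ} (ha : 0 ≤ a) :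
    ∫⁻ y, ENNReal.ofReal ((fixedIncrements φ δ κ μ).density st y) *
      ENNReal.ofReal (a + (fixedIncrements φ δ κ μ).weight st y * ‖g y‖ ^ 2) ∂μ ≤
      ENNReal.ofReal a +
        ENNReal.ofReal (1 / ((1 - κ) * ((1 - δ) / δ)) * ∫ x, ‖g x‖ ^ 2 ∂μ) := by
  have hr := h.lt_integral_fiR (κ := κ) hn hφm hφ hδ0 hδ hκ
  set r := ∫ y, fiR φ δ κ st y ∂μ with hr'
  have hc : 0 < (1 - κ) * ((1 - δ) / δ) :=
    mul_pos (sub_pos.2 hκ1) (div_pos (sub_pos.2 hδ) hδ0)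
  have hr0 : 0 < r := hc.trans hr
  have hR : Integrable (fun y => fiR φ δ κ st y / r) μ := (integrable_fiR hφm hφ).div_const r
  have hg2 : Integrable (fun x => ‖g x‖ ^ 2) μ := hg.integrable_norm_pow two_ne_zero
  have hg0 : 0 ≤ ∫ x, ‖g x‖ ^ 2 ∂μ := integral_nonneg fun _ => sq_nonneg _
  rw [← ENNReal.ofReal_add ha (by positivity)]
  -- Density times weight is 1/r where R > 0 and 0 elsewhere.
  refine (lintegral_ofReal_mul_le (M := fun y => fiR φ δ κ st y / r * a + 1 / r * ‖g y‖ ^ 2)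
    (fixedIncrements_density_nonneg hδ0 hδ hκ) (fun y => add_nonneg ha
      (mul_nonneg (fixedIncrements_weight_nonneg hδ0 hδ hκ y) (sq_nonneg _))) (fun y => ?_)
    ((hR.mul_const a).add (hg2.const_mul _))).trans (ENNReal.ofReal_le_ofReal ?_)
  · change fiR φ δ κ st y / r * (a + 1 / fiR φ δ κ st y * ‖g y‖ ^ 2) ≤ _
    rcases (fiR_nonneg (φ := φ) (st := st) hδ0 hδ hκ y).eq_or_lt with h0 | h0
    · rw [← h0]
      simp only [zero_div, zero_mul, zero_add]
      positivity
    · refine le_of_eq ?_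
      field_simp
  · rw [integral_add (hR.mul_const a) (hg2.const_mul _), integral_mul_const, integral_const_mul,
      integral_div, ← hr', div_self hr0.ne', one_mul]
    gcongr

end FixedIncrements

/-! ### From one step to the whole sample -/

theorem measurable_potential_state {X : Type*} [MeasurableSpace X] {n : ℕ} {φ : Fin n → X → ℂ}
    {S : Sampler X n} (hS : S.IsMeasurable) (hφ : ∀ j, Measurable (φ j)) (k : ℕ) :
    Measurable fun h : Fin k → X => potential (S.state φ k h) :=
  ((hS.state hφ k).1.resolvent (hS.state hφ k).2).rtrace

theorem mul_norm_sq_le_of_finalMatrix {X : Type*} [MeasurableSpace X] {μ : Measure X} {n m : ℕ}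
    {V : Submodule ℂ (Lp ℂ 2 μ)} (b : OrthonormalBasis (Fin n) ℂ V) {φ : Fin n → X → ℂ}
    {S : Sampler X n} {t : Fin m → X} {c : ℝ}
    (h : (S.finalMatrix φ t - (c : ℂ) • (1 : Matrix (Fin n) (Fin n) ℂ)).PosSemidef) (v : V) :
    c * ‖v‖ ^ 2 ≤ ∑ i, S.weights φ t i * ‖evalAt b φ v (t i)‖ ^ 2 :=
  mul_norm_sq_le b φ t (Sampler.finalMatrix_eq_sum t) h v

/-! ### Effective resistance: probability of E and error bound -/

section EffectiveResistance

variable {X : Type*} {n m : ℕ} {φ : Fin n → X → ℂ} {ε γ : ℝ}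

/-- At the final state one more barrier move is made, with no point drawn after it; A_m still lies
above. This is the origin of m + 1 in r. -/
theorem erBarrier_state (t : Fin m → X) :
    erBarrier ε γ ((effectiveResistance φ ε γ).state φ m t) = -(n : ℝ) + ∑ k : Fin (m + 1),
      ε / (potential ((effectiveResistance φ ε γ).state φ k
        (Fin.take (k : ℕ) (Nat.le_of_lt_succ k.2) t)) + γ) := by
  induction m with
  | zero => simp [erBarrier, potential, Sampler.state, State.init]
  | succ m ih =>
    rw [Fin.sum_univ_castSucc, ← add_assoc]
    exact congrArg₂ (· + ·) (ih (Fin.init t)) rfl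

variable [MeasurableSpace X] {μ : Measure X} [IsProbabilityMeasure μ]
  {V : Submodule ℂ (Lp ℂ 2 μ)} {b : OrthonormalBasis (Fin n) ℂ V}
  {Ω : Type*} [MeasurableSpace Ω] {P : Measure Ω} [IsProbabilityMeasure P] {x : Ω → Fin m → X}

theorem effectiveResistance_ae_weights_pos (hn : 1 ≤ n) (hφm : ∀ j, Measurable (φ j))
    (hφ : ∀ j, φ j =ᵐ[μ] ((b j : Lp ℂ 2 μ) : X → ℂ)) (hε0 : 0 < ε) (hε : ε < 1) (hγ : 0 ≤ γ)
    (hx : (effectiveResistance φ ε γ).IsSample μ φ P x) :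
    ∀ᵐ ω ∂P, ∀ i, 0 < (effectiveResistance φ ε γ).weights φ (x ω) i := by
  filter_upwards [hx.ae_density_pos (effectiveResistance_isMeasurable hφm) hφm] with ω hω i
  have hI := effectiveResistance_isInvariant hn hφ hε0 hε hγ
  exact effectiveResistance_weight_pos
    (above_erBarrier hn (hI.state (x ω) hω i i.isLt.le) hε hγ) hε0 hε hγ (hω i)

theorem measurableSet_finalMatrix (hφm : ∀ j, Measurable (φ j)) (hx : Measurable x) (c : ℝ) :
    MeasurableSet {ω | ((effectiveResistance φ ε γ).finalMatrix φ (x ω) -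
      (c : ℂ) • (1 : Matrix (Fin n) (Fin n) ℂ)).PosSemidef} :=
  measurableSet_posSemidef
    ((((effectiveResistance_isMeasurable hφm).state hφm m).comp hx).1.sub (entryMeasurable_const _))

/-- The supermartingale property, iterated with zero growth from the initial value 1. -/
theorem lintegral_potential_state_le (hn : 1 ≤ n) (hφm : ∀ j, Measurable (φ j))
    (hφ : ∀ j, φ j =ᵐ[μ] ((b j : Lp ℂ 2 μ) : X → ℂ)) (hε0 : 0 < ε) (hε : ε < 1) (hγ : 0 ≤ γ)
    (hx : (effectiveResistance φ ε γ).IsSample μ φ P x) (k : ℕ) (hk : k ≤ m) :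
    ∫⁻ ω, ENNReal.ofReal (potential ((effectiveResistance φ ε γ).state φ k
      (Fin.take k hk (x ω)))) ∂P ≤ 1 := by
  have hS := effectiveResistance_isMeasurable (ε := ε) (γ := γ) hφm
  have h := hx.lintegral_le hS hφm (effectiveResistance_isInvariant hn hφ hε0 hε hγ)
    (Φ := fun k h => ENNReal.ofReal (potential ((effectiveResistance φ ε γ).state φ k h)))
    (fun k => (measurable_potential_state hS hφm k).ennreal_ofReal) (C := 0)
    (fun k h hI => by
      simp_rw [Sampler.state_snoc, add_zero]
      exact lintegral_potential_le hn hφ hε0 hε hγ hI) k hk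
  have h1 : potential ((effectiveResistance φ ε γ).state φ 0 Fin.elim0) = 1 :=
    rtrace_resolvent_init hn
  rwa [mul_zero, add_zero, h1, ENNReal.ofReal_one] at h

variable {q : ℝ}

/-- The lower bound on the probability that the final matrix is large. -/
theorem le_measure_finalMatrix (hn : 1 ≤ n) (hφm : ∀ j, Measurable (φ j))
    (hφ : ∀ j, φ j =ᵐ[μ] ((b j : Lp ℂ 2 μ) : X → ℂ)) (hq : 1 < q)
    (hm : (m : ℝ) + 1 = n * q ^ 4)
    (hx : (effectiveResistance φ q⁻¹ (q ^ 2 - q)).IsSample μ φ P x) :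
    ENNReal.ofReal (1 - q⁻¹) ≤ P {ω | ((effectiveResistance φ q⁻¹ (q ^ 2 - q)).finalMatrix φ (x ω) -
      ((n * (q - 1) : ℝ) : ℂ) • (1 : Matrix (Fin n) (Fin n) ℂ)).PosSemidef} := by
  have hq0 : 0 < q := one_pos.trans hq
  have hε0 : 0 < q⁻¹ := inv_pos.2 hq0
  have hε : q⁻¹ < 1 := inv_lt_one_of_one_lt₀ hq
  have hγ : 0 < q ^ 2 - q := by nlinarith
  have hS := effectiveResistance_isMeasurable (ε := q⁻¹) (γ := q ^ 2 - q) hφm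
  have hI := effectiveResistance_isInvariant hn hφ hε0 hε hγ.le
  set S := effectiveResistance φ q⁻¹ (q ^ 2 - q)
  set E := {ω | (S.finalMatrix φ (x ω) -
      ((n * (q - 1) : ℝ) : ℂ) • (1 : Matrix (Fin n) (Fin n) ℂ)).PosSemidef}
  have hE : MeasurableSet E := measurableSet_finalMatrix hφm hx.1 _
  set τ : Fin (m + 1) → Ω → ℝ := fun k ω =>
    potential (S.state φ k (Fin.take (k : ℕ) (Nat.le_of_lt_succ k.2) (x ω)))
  have hτm : ∀ k, Measurable (τ k) := fun k =>
    (measurable_potential_state hS hφm k).comp ((Sampler.measurable_take _).comp hx.1)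
  set U : Ω → ℝ≥0∞ := fun ω => ∑ k, ENNReal.ofReal (τ k ω)
  have hU : ∫⁻ ω, U ω ∂P ≤ (m : ℝ≥0∞) + 1 := by
    rw [lintegral_finsetSum _ fun k _ => (hτm k).ennreal_ofReal]
    have h1 : ∀ k, ∫⁻ ω, ENNReal.ofReal (τ k ω) ∂P ≤ 1 := fun k =>
      lintegral_potential_state_le hn hφm hφ hε0 hε hγ.le hx k (Nat.le_of_lt_succ k.2)
    refine (Finset.sum_le_sum fun k _ => h1 k).trans ?_
    simp
  have hN : (0 : ℝ) < m + 1 := by positivity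
  set c : ℝ≥0∞ := ENNReal.ofReal ((m + 1) * q)
  -- Markov's inequality at q times the bound m + 1 on the mean.
  have hmarkov : P {ω | c ≤ U ω} ≤ ENNReal.ofReal q⁻¹ := by
    have h := mul_meas_ge_le_lintegral (μ := P)
      (Finset.measurable_fun_sum Finset.univ fun k _ => (hτm k).ennreal_ofReal) c
    have e : (m : ℝ≥0∞) + 1 = c * ENNReal.ofReal q⁻¹ := by
      rw [← ENNReal.ofReal_mul (by positivity), mul_assoc, mul_inv_cancel₀ hq0.ne', mul_one,
        ENNReal.ofReal_add (by positivity) zero_le_one, ENNReal.ofReal_natCast, ENNReal.ofReal_one]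
    have hc0 : c ≠ 0 := (ENNReal.ofReal_pos.2 (by positivity)).ne'
    exact (ENNReal.mul_le_mul_iff_right hc0 ENNReal.ofReal_ne_top).1 (h.trans (hU.trans_eq e))
  have hsub : ∀ᵐ ω ∂P, ω ∈ Eᶜ → ω ∈ {ω | c ≤ U ω} := by
    filter_upwards [hx.ae_density_pos hS hφm] with ω hω hωE
    by_contra hlt
    refine hωE ?_
    have hab : ∀ k (hk : k ≤ m), Above (S.state φ k (Fin.take k hk (x ω))).A
      (S.state φ k (Fin.take k hk (x ω))).barrier := hI.state (x ω) hω
    have hτ : ∀ k, 0 < τ k ω := fun k => (hab k _).rtrace_pos hn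
    have hfin := above_erBarrier hn (hab m le_rfl) hε hγ.le
    refine Above.posSemidef hfin ?_
    have hsum : ∑ k, τ k ω < (m + 1) * q := by
      have h1 : U ω < c := not_le.1 hlt
      simp only [U] at h1
      rw [← ENNReal.ofReal_sum_of_nonneg fun k _ => (hτ k).le] at h1
      exact (ENNReal.ofReal_lt_ofReal_iff (by positivity)).1 h1
    rw [Fin.take_eq_self]
    refine le_trans ?_ (erBarrier_state (x ω)).ge
    -- Cauchy-Schwarz: the sum of 1/(τ_k + γ) is at least (m + 1)² / ∑ (τ_k + γ).
    have hcs := Finset.sq_sum_div_le_sum_sq_div Finset.univ (fun _ : Fin (m + 1) => (1 : ℝ))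
      (g := fun k => τ k ω + (q ^ 2 - q)) fun k _ => add_pos (hτ k) hγ
    simp only [Finset.sum_const, Finset.card_univ, Fintype.card_fin, nsmul_eq_mul, mul_one,
      one_pow, Finset.sum_add_distrib] at hcs
    push_cast at hcs
    -- The choice γ = q² - q makes the Markov level q plus γ equal to q².
    have hden : ∑ k, τ k ω + ((m : ℝ) + 1) * (q ^ 2 - q) ≤ (m + 1) * q ^ 2 := by nlinarith
    have hden0 : 0 < ∑ k, τ k ω + ((m : ℝ) + 1) * (q ^ 2 - q) :=
      add_pos_of_nonneg_of_pos (Finset.sum_nonneg fun k _ => (hτ k).le) (by positivity)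
    have h2 : (n : ℝ) * q ^ 2 ≤ ∑ k, 1 / (τ k ω + (q ^ 2 - q)) := by
      refine le_trans ?_ hcs
      rw [le_div_iff₀ hden0]
      calc (n : ℝ) * q ^ 2 * (∑ k, τ k ω + ((m : ℝ) + 1) * (q ^ 2 - q))
          ≤ n * q ^ 2 * ((m + 1) * q ^ 2) := by gcongr
        _ = ((m : ℝ) + 1) ^ 2 := by rw [hm]; ring
    have h3 : ∑ k, q⁻¹ / (τ k ω + (q ^ 2 - q)) = q⁻¹ * ∑ k, 1 / (τ k ω + (q ^ 2 - q)) := by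
      rw [Finset.mul_sum]
      exact Finset.sum_congr rfl fun k _ => by ring
    change _ ≤ -(n : ℝ) + ∑ k, q⁻¹ / (τ k ω + (q ^ 2 - q))
    rw [h3]
    -- The increments sum to at least q⁻¹ · nq² = nq, and the start -n leaves n(q - 1).
    have h4 := mul_le_mul_of_nonneg_left h2 hε0.le
    have h5 : q⁻¹ * (n * q ^ 2) = n * q := by field_simp
    linarith
  have hEc : P Eᶜ ≤ ENNReal.ofReal q⁻¹ := (measure_mono_ae hsub).trans hmarkov
  rw [ENNReal.ofReal_sub _ hε0.le, ENNReal.ofReal_one, tsub_le_iff_right,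
    ← prob_add_prob_compl (μ := P) hE]
  gcongr

/-- The residual starts at 0 and has centred increments, so its second moment is at most m times the
one-step variance bound. -/
theorem lintegral_residual_state_le (hn : 1 ≤ n) (hφm : ∀ j, Measurable (φ j))
    (hφ : ∀ j, φ j =ᵐ[μ] ((b j : Lp ℂ 2 μ) : X → ℂ)) (hε0 : 0 < ε) (hε : ε < 1) (hγ : 0 < γ)
    (hx : (effectiveResistance φ ε γ).IsSample μ φ P x) {g : X → ℂ} (hgm : Measurable g)
    (hg : MemLp g 2 μ) (hort : ∀ j, ∫ x, star (φ j x) * g x ∂μ = 0) :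
    ∫⁻ ω, ENNReal.ofReal (∑ j, ‖residual φ (effectiveResistance φ ε γ) g (x ω) j‖ ^ 2) ∂P ≤
      m * ENNReal.ofReal ((ε / (1 - ε)) ^ 2 * n / γ ^ 2 * ∫ x, ‖g x‖ ^ 2 ∂μ) := by
  have hS := effectiveResistance_isMeasurable (ε := ε) (γ := γ) hφm
  have h := hx.lintegral_le hS hφm (effectiveResistance_isInvariant hn hφ hε0 hε hγ.le)
    (Φ := fun k h => ENNReal.ofReal
      (∑ j, ‖residual φ (effectiveResistance φ ε γ) g h j‖ ^ 2))
    (fun k => (Finset.measurable_fun_sum _ fun j _ =>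
      (measurable_residual hS hφm hgm j).norm.pow_const 2).ennreal_ofReal)
    (C := ENNReal.ofReal ((ε / (1 - ε)) ^ 2 * n / γ ^ 2 * ∫ x, ‖g x‖ ^ 2 ∂μ))
    (fun k h hI => by
      simp_rw [residual_snoc]
      exact lintegral_residual_le hn hφ hε0 hε hγ hg hort hI _) m le_rfl
  simpa [Fin.take_eq_self, residual] using h

theorem lintegral_errL2_cond_le (hn : 1 ≤ n) (hφm : ∀ j, Measurable (φ j))
    (hφ : ∀ j, φ j =ᵐ[μ] ((b j : Lp ℂ 2 μ) : X → ℂ)) {f : X → ℂ} (hf : AEStronglyMeasurable f μ)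
    (hq : 1 < q) (hm : (m : ℝ) + 1 = n * q ^ 4)
    (hx : (effectiveResistance φ q⁻¹ (q ^ 2 - q)).IsSample μ φ P x) {E : Set Ω}
    (hE : E = {ω | ((effectiveResistance φ q⁻¹ (q ^ 2 - q)).finalMatrix φ (x ω) -
      ((n * (q - 1) : ℝ) : ℂ) • (1 : Matrix (Fin n) (Fin n) ℂ)).PosSemidef})
    {ft : Ω → V} (hft : ∀ᵐ ω ∂(ProbabilityTheory.cond P E), IsLeastSquares b φ f
      ((effectiveResistance φ q⁻¹ (q ^ 2 - q)).weights φ (x ω)) (x ω) (ft ω)) :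
    ∫⁻ ω, errL2 f (ft ω) ^ 2 ∂(ProbabilityTheory.cond P E) ≤
      ENNReal.ofReal (1 + 1 / (q ^ 4 * (1 - q⁻¹) ^ 7)) * bestError V 2 f ^ 2 := by
  have hq0 : 0 < q := one_pos.trans hq
  have hε0 : 0 < q⁻¹ := inv_pos.2 hq0
  have hε : q⁻¹ < 1 := inv_lt_one_of_one_lt₀ hq
  have hp : 0 < 1 - q⁻¹ := sub_pos.2 hε
  have hγ : 0 < q ^ 2 - q := by nlinarith
  have hn' : (0 : ℝ) < n := by exact_mod_cast hn
  -- An infinite best error makes the right-hand side infinite, its constant being positive.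
  by_cases htop : bestError V 2 f = ∞
  · rw [htop, ENNReal.top_pow two_ne_zero,
      ENNReal.mul_top (ENNReal.ofReal_pos.2 (by positivity)).ne']
    exact le_top
  obtain ⟨w, g, hgm, hg, hgf, hort, hgn, herr⟩ := exists_bestApproximation b hφ hf htop
  have hPE := le_measure_finalMatrix hn hφm hφ hq hm hx
  have hξ := lintegral_residual_state_le hn hφm hφ hε0 hε hγ hx hgm hg hort
  have hpos := effectiveResistance_ae_weights_pos hn hφm hφ hε0 hε hγ.le hx
  have hEm : MeasurableSet E := hE ▸ measurableSet_finalMatrix hφm hx.1 _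
  have hmem := hx.ae_mem (effectiveResistance_isMeasurable hφm) hφm hgf
  set S := effectiveResistance φ q⁻¹ (q ^ 2 - q)
  rw [← hE] at hPE
  have hPE0 : P E ≠ 0 := ((ENNReal.ofReal_pos.2 hp).trans_le hPE).ne'
  have hprob : IsProbabilityMeasure (ProbabilityTheory.cond P E) :=
    ProbabilityTheory.cond_isProbabilityMeasure hPE0
  set c : ℝ := n * (q - 1) with hc
  have hc0 : 0 < c := mul_pos hn' (sub_pos.2 hq)
  set ξ : Ω → ℝ := fun ω => ∑ j, ‖residual φ S g (x ω) j‖ ^ 2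
  have hbound : ∀ᵐ ω ∂(ProbabilityTheory.cond P E), errL2 f (ft ω) ^ 2 ≤
      bestError V 2 f ^ 2 + ENNReal.ofReal (c ^ 2)⁻¹ * ENNReal.ofReal (ξ ω) := by
    have hac := ProbabilityTheory.cond_absolutelyContinuous (μ := P) (s := E)
    filter_upwards [hft, hac.ae_le hpos, hac.ae_le hmem,
      ProbabilityTheory.ae_cond_mem hEm] with ω h1 h2 h3 h4
    rw [hE] at h4
    have h5 := sq_mul_norm_sub_sq_le_sum b φ (x ω) (fun i => (h2 i).le) hc0.le
      (mul_norm_sq_le_of_finalMatrix b h4) h1 w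
    simp_rw [h3] at h5
    rw [herr, ← ENNReal.ofReal_mul (by positivity)]
    gcongr
    rw [inv_mul_eq_div, le_div_iff₀ (by positivity), mul_comm]
    exact h5
  -- Conditioning restricts to E and divides by P(E) ≥ 1 - q⁻¹.
  have hcond : ∫⁻ ω, ENNReal.ofReal (ξ ω) ∂(ProbabilityTheory.cond P E) ≤
      ENNReal.ofReal (1 - q⁻¹)⁻¹ * ∫⁻ ω, ENNReal.ofReal (ξ ω) ∂P := by
    rw [ProbabilityTheory.cond, lintegral_smul_measure, smul_eq_mul, ENNReal.ofReal_inv_of_pos hp]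
    gcongr
    exact Measure.restrict_le_self
  set G := ∫ x, ‖g x‖ ^ 2 ∂μ
  have hG : 0 ≤ G := integral_nonneg fun _ => sq_nonneg _
  set K := (q⁻¹ / (1 - q⁻¹)) ^ 2 * n / (q ^ 2 - q) ^ 2 with hK
  have hK0 : 0 ≤ K := by positivity
  calc ∫⁻ ω, errL2 f (ft ω) ^ 2 ∂(ProbabilityTheory.cond P E)
      ≤ ∫⁻ ω, (bestError V 2 f ^ 2 + ENNReal.ofReal (c ^ 2)⁻¹ * ENNReal.ofReal (ξ ω))
          ∂(ProbabilityTheory.cond P E) := lintegral_mono_ae hbound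
    _ = bestError V 2 f ^ 2 + ENNReal.ofReal (c ^ 2)⁻¹ *
          ∫⁻ ω, ENNReal.ofReal (ξ ω) ∂(ProbabilityTheory.cond P E) := by
        rw [lintegral_add_left measurable_const, lintegral_const, measure_univ, mul_one,
          lintegral_const_mul' _ _ ENNReal.ofReal_ne_top]
    _ ≤ bestError V 2 f ^ 2 + ENNReal.ofReal (c ^ 2)⁻¹ *
          (ENNReal.ofReal (1 - q⁻¹)⁻¹ * (m * ENNReal.ofReal (K * G))) := by
        gcongr
        exact hcond.trans (by gcongr)
    _ = ENNReal.ofReal (G + (c ^ 2)⁻¹ * ((1 - q⁻¹)⁻¹ * (m * (K * G)))) := by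
        rw [← hgn, ← ENNReal.ofReal_natCast m, ← ENNReal.ofReal_mul m.cast_nonneg,
          ← ENNReal.ofReal_mul (by positivity), ← ENNReal.ofReal_mul (by positivity),
          ← ENNReal.ofReal_add hG (by positivity)]
    _ ≤ ENNReal.ofReal ((1 + 1 / (q ^ 4 * (1 - q⁻¹) ^ 7)) * G) := by
        refine ENNReal.ofReal_le_ofReal ?_
        -- The seven factors p = 1 - q⁻¹: two each from η², γ² and c², and one from conditioning.
        have e : (c ^ 2)⁻¹ * ((1 - q⁻¹)⁻¹ * (m * K)) =
            (m / (n * q ^ 4)) * (1 / (q ^ 4 * (1 - q⁻¹) ^ 7)) := by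
          have e1 : q ^ 2 - q = q ^ 2 * (1 - q⁻¹) := by field_simp
          have e2 : q - 1 = q * (1 - q⁻¹) := by field_simp
          rw [hK, hc, e1, e2]
          generalize 1 - q⁻¹ = p at hp
          field_simp
        -- The denominator is m + 1.
        have h1 : (m : ℝ) / (n * q ^ 4) ≤ 1 := by
          rw [div_le_one (by positivity), ← hm]
          linarith
        have h2 : (c ^ 2)⁻¹ * ((1 - q⁻¹)⁻¹ * (m * K)) ≤ 1 / (q ^ 4 * (1 - q⁻¹) ^ 7) := by
          rw [e]
          exact mul_le_of_le_one_left (by positivity) h1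
        calc G + (c ^ 2)⁻¹ * ((1 - q⁻¹)⁻¹ * (m * (K * G)))
            = (1 + (c ^ 2)⁻¹ * ((1 - q⁻¹)⁻¹ * (m * K))) * G := by ring
          _ ≤ _ := by gcongr
    _ = _ := by rw [ENNReal.ofReal_mul (by positivity), hgn]

end EffectiveResistance

/-! ### Fixed increments: stability and error bounds -/

section FixedIncrements

variable {X : Type*} [MeasurableSpace X] {μ : Measure X} {n m : ℕ} {φ : Fin n → X → ℂ} {δ κ : ℝ}

theorem barrier_fixedIncrements_state (t : Fin m → X) :
    ((fixedIncrements φ δ κ μ).state φ m t).barrier = -(n : ℝ) + m * δ := by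
  induction m with
  | zero => simp [Sampler.state, State.init]
  | succ m ih =>
    rw [Sampler.state_succ]
    change ((fixedIncrements φ δ κ μ).state φ m (Fin.init t)).barrier + δ = _
    rw [ih]
    push_cast
    ring

variable [IsProbabilityMeasure μ]
  {V : Submodule ℂ (Lp ℂ 2 μ)} {b : OrthonormalBasis (Fin n) ℂ V}
  {Ω : Type*} [MeasurableSpace Ω] {P : Measure Ω} [IsProbabilityMeasure P] {x : Ω → Fin m → X}

/-- Potential 1 puts A_m above the barrier plus 1, and -n + mδ + 1 = mδ - mδ² because mδ² = n - 1.
-/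
theorem fixedIncrements_posSemidef (hn : 1 ≤ n) (hφm : ∀ j, Measurable (φ j))
    (hφ : ∀ j, φ j =ᵐ[μ] ((b j : Lp ℂ 2 μ) : X → ℂ)) (hδ0 : 0 < δ) (hδ : δ < 1) (hκ : 0 ≤ κ)
    (hκ1 : κ ≤ 1) (hm : m * δ ^ 2 = (n : ℝ) - 1) {t : Fin m → X}
    (ht : ∀ i, 0 < (fixedIncrements φ δ κ μ).density
      ((fixedIncrements φ δ κ μ).stateBefore φ t i) (t i)) :
    ((fixedIncrements φ δ κ μ).finalMatrix φ t -
      ((m * (δ * (1 - δ)) : ℝ) : ℂ) • (1 : Matrix (Fin n) (Fin n) ℂ)).PosSemidef := by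
  have h : UnitPotential ((fixedIncrements φ δ κ μ).state φ m t) :=
    (fixedIncrements_isInvariant hn hφm hφ hδ0 hδ hκ hκ1).state t ht m le_rfl
  have h1 := h.1.posSemidef_inv_rtrace
  have h2 : rtrace (resolvent ((fixedIncrements φ δ κ μ).state φ m t).A
    ((fixedIncrements φ δ κ μ).state φ m t).barrier) = 1 := h.2
  rw [h2, barrier_fixedIncrements_state] at h1
  have e : (m : ℝ) * (δ * (1 - δ)) = -(n : ℝ) + m * δ + 1⁻¹ := by
    rw [inv_one]
    linear_combination -hm
  rw [e]
  exact h1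

theorem lintegral_fixedIncrements_sum_le (hn : 1 ≤ n) (hφm : ∀ j, Measurable (φ j))
    (hφ : ∀ j, φ j =ᵐ[μ] ((b j : Lp ℂ 2 μ) : X → ℂ)) (hδ0 : 0 < δ) (hδ : δ < 1) (hκ : 0 ≤ κ)
    (hκ1 : κ < 1) (hx : (fixedIncrements φ δ κ μ).IsSample μ φ P x) {g : X → ℂ}
    (hgm : Measurable g) (hg : MemLp g 2 μ) :
    ∫⁻ ω, ENNReal.ofReal
        (∑ i, (fixedIncrements φ δ κ μ).weights φ (x ω) i * ‖g (x ω i)‖ ^ 2) ∂P ≤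
      m * ENNReal.ofReal (1 / ((1 - κ) * ((1 - δ) / δ)) * ∫ x, ‖g x‖ ^ 2 ∂μ) := by
  have hS := fixedIncrements_isMeasurable (δ := δ) (κ := κ) (μ := μ) hφm
  have hw : ∀ {k : ℕ} (h : Fin k → X) (i : Fin k),
      0 ≤ (fixedIncrements φ δ κ μ).weights φ h i := fun h i =>
    fixedIncrements_weight_nonneg hδ0 hδ hκ (h i)
  set S := fixedIncrements φ δ κ μ with hSdef
  set C := ENNReal.ofReal (1 / ((1 - κ) * ((1 - δ) / δ)) * ∫ x, ‖g x‖ ^ 2 ∂μ)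
  set Φ : (k : ℕ) → (Fin k → X) → ℝ≥0∞ := fun k h =>
    ENNReal.ofReal (∑ i, S.weights φ h i * ‖g (h i)‖ ^ 2) with hΦ
  have hΦm : ∀ k, Measurable (Φ k) := fun k =>
    (Finset.measurable_fun_sum _ fun i _ => (hS.weights hφm i).mul
      ((hgm.comp (measurable_pi_apply i)).norm.pow_const 2)).ennreal_ofReal
  have hstep : ∀ k h, UnitPotential (S.state φ k h) →
      ∫⁻ y, ENNReal.ofReal (S.density (S.state φ k h) y) *
        Φ (k + 1) (Fin.snoc (α := fun _ => X) h y) ∂μ ≤ Φ k h + C := by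
    intro k h hI
    have h0 := hI.lintegral_weight_mul_le hn hφm hφ hδ0 hδ hκ hκ1 hg
      (Finset.sum_nonneg fun i (_ : i ∈ Finset.univ) =>
        mul_nonneg (hw h i) (sq_nonneg ‖g (h i)‖))
    simp only [hΦ, Fin.sum_univ_castSucc, Sampler.weights_castSucc, Sampler.weights_last,
      Fin.init_snoc, Fin.snoc_last, Fin.snoc_castSucc]
    exact h0
  have h := hx.lintegral_le hS hφm (fixedIncrements_isInvariant hn hφm hφ hδ0 hδ hκ hκ1.le)
    hΦm hstep m le_rfl
  have h0 : Φ 0 Fin.elim0 = 0 := by simp [hΦ]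
  simp_rw [Fin.take_eq_self] at h
  rwa [h0, zero_add] at h

variable {f : X → ℂ} {ft : Ω → V}

theorem lintegral_errL2_fixedIncrements_le (hn : 1 ≤ n) (hφm : ∀ j, Measurable (φ j))
    (hφ : ∀ j, φ j =ᵐ[μ] ((b j : Lp ℂ 2 μ) : X → ℂ)) (hf : AEStronglyMeasurable f μ)
    (hδ0 : 0 < δ) (hδ : δ < 1) (hκ : 0 ≤ κ) (hκ1 : κ < 1) (hm0 : 0 < m)
    (hm : m * δ ^ 2 = (n : ℝ) - 1) (hx : (fixedIncrements φ δ κ μ).IsSample μ φ P x)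
    (hft : ∀ᵐ ω ∂P, IsLeastSquares b φ f
      ((fixedIncrements φ δ κ μ).weights φ (x ω)) (x ω) (ft ω)) :
    ∫⁻ ω, errL2 f (ft ω) ^ 2 ∂P ≤
      ENNReal.ofReal (1 + 1 / (1 - κ) * (1 / (1 - δ) ^ 2)) * bestError V 2 f ^ 2 := by
  have hm0' : (0 : ℝ) < m := by exact_mod_cast hm0
  have hδ' : 0 < 1 - δ := sub_pos.2 hδ
  have hκ' : 0 < 1 - κ := sub_pos.2 hκ1
  by_cases htop : bestError V 2 f = ∞
  · rw [htop, ENNReal.top_pow two_ne_zero,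
      ENNReal.mul_top (ENNReal.ofReal_pos.2 (by positivity)).ne']
    exact le_top
  obtain ⟨w, g, hgm, hg, hgf, -, hgn, herr⟩ := exists_bestApproximation b hφ hf htop
  have hsum := lintegral_fixedIncrements_sum_le hn hφm hφ hδ0 hδ hκ hκ1 hx hgm hg
  have hS := fixedIncrements_isMeasurable (δ := δ) (κ := κ) (μ := μ) hφm
  set S := fixedIncrements φ δ κ μ
  set ξ : Ω → ℝ := fun ω => ∑ i, S.weights φ (x ω) i * ‖g (x ω i)‖ ^ 2
  set c : ℝ := m * (δ * (1 - δ)) with hc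
  have hc0 : 0 < c := by positivity
  have hbound : ∀ᵐ ω ∂P, errL2 f (ft ω) ^ 2 ≤
      bestError V 2 f ^ 2 + ENNReal.ofReal c⁻¹ * ENNReal.ofReal (ξ ω) := by
    filter_upwards [hft, hx.ae_mem hS hφm hgf, hx.ae_density_pos hS hφm] with ω h1 h2 h3
    -- The discrete contraction loses c only once, so c = mδ(1 - δ) absorbs the factor m from the m
    -- steps.
    have h4 := mul_norm_sub_sq_le_sum b φ (x ω)
      (fun i => fixedIncrements_weight_nonneg hδ0 hδ hκ _)
      (mul_norm_sq_le_of_finalMatrix b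
        (fixedIncrements_posSemidef hn hφm hφ hδ0 hδ hκ hκ1.le hm h3)) h1 w
    simp_rw [h2] at h4
    rw [herr, ← ENNReal.ofReal_mul (by positivity)]
    gcongr
    rw [inv_mul_eq_div, le_div_iff₀ hc0, mul_comm]
    exact h4
  set G := ∫ x, ‖g x‖ ^ 2 ∂μ
  have hG : 0 ≤ G := integral_nonneg fun _ => sq_nonneg _
  calc ∫⁻ ω, errL2 f (ft ω) ^ 2 ∂P
      ≤ ∫⁻ ω, (bestError V 2 f ^ 2 + ENNReal.ofReal c⁻¹ * ENNReal.ofReal (ξ ω)) ∂P :=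
        lintegral_mono_ae hbound
    _ = bestError V 2 f ^ 2 + ENNReal.ofReal c⁻¹ * ∫⁻ ω, ENNReal.ofReal (ξ ω) ∂P := by
        rw [lintegral_add_left measurable_const, lintegral_const, measure_univ, mul_one,
          lintegral_const_mul' _ _ ENNReal.ofReal_ne_top]
    _ ≤ bestError V 2 f ^ 2 + ENNReal.ofReal c⁻¹ *
          (m * ENNReal.ofReal (1 / ((1 - κ) * ((1 - δ) / δ)) * G)) := by gcongr
    _ = ENNReal.ofReal (G + c⁻¹ * (m * (1 / ((1 - κ) * ((1 - δ) / δ)) * G))) := by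
        rw [← hgn, ← ENNReal.ofReal_natCast m, ← ENNReal.ofReal_mul m.cast_nonneg,
          ← ENNReal.ofReal_mul (by positivity), ← ENNReal.ofReal_add hG (by positivity)]
    _ = ENNReal.ofReal ((1 + 1 / (1 - κ) * (1 / (1 - δ) ^ 2)) * G) := by
        congr 1
        rw [hc]
        field_simp
    _ = _ := by rw [ENNReal.ofReal_mul (by positivity), hgn]

theorem ae_errL2_fixedIncrements_le (hn : 1 ≤ n) (hφm : ∀ j, Measurable (φ j))
    (hφ : ∀ j, φ j =ᵐ[μ] ((b j : Lp ℂ 2 μ) : X → ℂ)) (hf : AEStronglyMeasurable f μ)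
    (hδ0 : 0 < δ) (hδ : δ < 1) (hκ : 0 < κ) (hκ1 : κ ≤ 1) (hm0 : 0 < m)
    (hm : m * δ ^ 2 = (n : ℝ) - 1) (hx : (fixedIncrements φ δ κ μ).IsSample μ φ P x)
    (hft : ∀ᵐ ω ∂P, IsLeastSquares b φ f
      ((fixedIncrements φ δ κ μ).weights φ (x ω)) (x ω) (ft ω)) :
    ∀ᵐ ω ∂P, errL2 f (ft ω) ≤
      ENNReal.ofReal (1 + 1 / √κ * (1 / (1 - δ))) * bestError V ∞ f := by
  have hm0' : (0 : ℝ) < m := by exact_mod_cast hm0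
  have hδ' : 0 < 1 - δ := sub_pos.2 hδ
  have hS := fixedIncrements_isMeasurable (δ := δ) (κ := κ) (μ := μ) hφm
  set S := fixedIncrements φ δ κ μ
  have hsκ : 0 < √κ := Real.sqrt_pos.2 hκ
  set C : ℝ := 1 + 1 / √κ * (1 / (1 - δ)) with hC
  have hC0 : 0 < C := by positivity
  -- The exceptional null set depends on the competitor v, so v is fixed first; the infimum is
  -- reached afterwards along a sequence.
  have hv : ∀ v : V, ∀ᵐ ω ∂P, errL2 f (ft ω) ≤ ENNReal.ofReal C *
      eLpNorm (fun y => f y - ((v : Lp ℂ 2 μ) : X → ℂ) y) ∞ μ := by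
    intro v
    set B := eLpNorm (fun y => f y - ((v : Lp ℂ 2 μ) : X → ℂ) y) ∞ μ with hB
    by_cases htop : B = ∞
    · rw [htop, ENNReal.mul_top (ENNReal.ofReal_pos.2 hC0).ne']
      exact Filter.Eventually.of_forall fun _ => le_top
    have hle : ∀ᵐ y ∂μ, ‖f y - evalAt b φ v y‖ ≤ B.toReal := by
      have h1 := enorm_ae_le_eLpNormEssSup (fun y => f y - ((v : Lp ℂ 2 μ) : X → ℂ) y) μ
      rw [← eLpNorm_exponent_top, ← hB] at h1
      filter_upwards [h1, evalAt_ae_eq b hφ v] with y h2 h3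
      rw [h3, ← toReal_enorm]
      exact ENNReal.toReal_mono htop h2
    filter_upwards [hft, hx.ae_mem hS hφm hle, hx.ae_density_pos hS hφm] with ω h1 h2 h3
    have h4 := mul_norm_sub_sq_le_sum b φ (x ω)
      (fun i => fixedIncrements_weight_nonneg hδ0 hδ hκ.le _)
      (mul_norm_sq_le_of_finalMatrix b
        (fixedIncrements_posSemidef hn hφm hφ hδ0 hδ hκ.le hκ1 hm h3)) h1 v
    -- Drawn points have R at least the threshold, so each of the m weights is at most δ/(κ(1 - δ)).
    have h5 : ∑ i, S.weights φ (x ω) i * ‖f (x ω i) - evalAt b φ v (x ω i)‖ ^ 2 ≤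
        m * (1 / (κ * ((1 - δ) / δ)) * B.toReal ^ 2) := by
      refine (Finset.sum_le_sum fun i _ => mul_le_mul
        (fixedIncrements_weight_le hδ0 hδ hκ (h3 i))
        (pow_le_pow_left₀ (norm_nonneg _) (h2 i) 2) (sq_nonneg _) (by positivity)).trans_eq ?_
      simp
    have h6 : ‖ft ω - v‖ ≤ 1 / √κ * (1 / (1 - δ)) * B.toReal := by
      refine le_of_sq_le_sq ?_ (by positivity)
      have e : m * (δ * (1 - δ)) * (1 / √κ * (1 / (1 - δ)) * B.toReal) ^ 2 =
          m * (1 / (κ * ((1 - δ) / δ)) * B.toReal ^ 2) := by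
        have : √κ ^ 2 = κ := Real.sq_sqrt hκ.le
        rw [mul_pow, mul_pow, div_pow, this]
        field_simp
      exact le_of_mul_le_mul_left ((h4.trans h5).trans_eq e.symm) (by positivity)
    -- On a probability space the L² norm is at most the L^∞ norm.
    have h7 : errL2 f v ≤ B := eLpNorm_le_eLpNorm_of_exponent_le le_top
      (hf.sub (Lp.aestronglyMeasurable _))
    calc errL2 f (ft ω) ≤ errL2 f v + ENNReal.ofReal ‖ft ω - v‖ := errL2_le_add hf _ _
      _ ≤ B + ENNReal.ofReal (1 / √κ * (1 / (1 - δ)) * B.toReal) := by gcongr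
      _ = ENNReal.ofReal C * B := by
        rw [ENNReal.ofReal_mul (by positivity), ENNReal.ofReal_toReal htop, hC,
          ENNReal.ofReal_add zero_le_one (by positivity), ENNReal.ofReal_one, add_mul, one_mul]
  -- A minimizing sequence needs only countably many null sets.
  obtain ⟨u, -, hu, hlim⟩ := exists_seq_tendsto_sInf (S := Set.range fun v : V =>
    eLpNorm (fun y => f y - ((v : Lp ℂ 2 μ) : X → ℂ) y) ∞ μ) (Set.range_nonempty _) (OrderBot.bddBelow _)
  choose v hvu using hlim
  filter_upwards [ae_all_iff.2 fun k => hv (v k)] with ω hω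
  refine ge_of_tendsto' (ENNReal.Tendsto.const_mul hu (Or.inr ENNReal.ofReal_ne_top)) fun k => ?_
  rw [← hvu k]
  exact hω k

end FixedIncrements

end BarrierSampling

end

/-! ### The theorem: substituting the parameters -/

open BarrierSampling in
theorem theorem1p1 {X : Type*} [MeasurableSpace X] (μ : Measure X) [IsProbabilityMeasure μ]
    (n m : ℕ) (hn : 1 ≤ n) (hm : n ≤ m)
    (V : Submodule ℂ (Lp ℂ 2 μ)) (b : OrthonormalBasis (Fin n) ℂ V)
    (φ : Fin n → X → ℂ) (hφm : ∀ j, Measurable (φ j))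
    (hφ : ∀ j, φ j =ᵐ[μ] ((b j : Lp ℂ 2 μ) : X → ℂ))
    (f : X → ℂ) (hf : AEStronglyMeasurable f μ) :
    -- sampling by effective resistance, conditioned on the event `E = {A_m ≽ n (r^{1/4} - 1) I}`
    (∀ r : ℝ, r = ((m : ℝ) + 1) / n →
      ∀ S : BarrierSampling.Sampler X n,
        S = BarrierSampling.effectiveResistance φ
          (r ^ (-(1 / 4) : ℝ)) (r ^ (1 / 2 : ℝ) - r ^ (1 / 4 : ℝ)) →
      (∃ Q : Measure (Fin m → X), IsProbabilityMeasure Q ∧ S.IsSample μ φ Q id) ∧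
      ∀ (Ω : Type*) [MeasurableSpace Ω] (P : Measure Ω) [IsProbabilityMeasure P]
        (x : Ω → Fin m → X), S.IsSample μ φ P x →
        ∀ E : Set Ω, E = {ω | (S.finalMatrix φ (x ω) -
            ((n * (r ^ (1 / 4 : ℝ) - 1) : ℝ) : ℂ) • (1 : Matrix (Fin n) (Fin n) ℂ)).PosSemidef} →
          MeasurableSet E ∧ ENNReal.ofReal (1 - r ^ (-(1 / 4) : ℝ)) ≤ P E ∧
          (∀ᵐ ω ∂P, ∀ i, 0 < S.weights φ (x ω) i) ∧
          (∀ᵐ ω ∂(ProbabilityTheory.cond P E), ∃! v : V,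
            BarrierSampling.IsLeastSquares b φ f (S.weights φ (x ω)) (x ω) v) ∧
          ∀ ft : Ω → V,
            (∀ᵐ ω ∂(ProbabilityTheory.cond P E),
              BarrierSampling.IsLeastSquares b φ f (S.weights φ (x ω)) (x ω) (ft ω)) →
            ∫⁻ ω, BarrierSampling.errL2 f (ft ω) ^ 2 ∂(ProbabilityTheory.cond P E) ≤
              ENNReal.ofReal (1 + 1 / (r * (1 - r ^ (-(1 / 4) : ℝ)) ^ 7)) *
                BarrierSampling.bestError V 2 f ^ 2) ∧
    -- sampling with fixed increments of the barrier
    (2 ≤ n → ∀ r : ℝ, r = (m : ℝ) / ((n : ℝ) - 1) →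
      ∀ κ : ℝ, 0 ≤ κ → κ ≤ 1 →
      ∀ S : BarrierSampling.Sampler X n,
        S = BarrierSampling.fixedIncrements φ (r ^ (-(1 / 2) : ℝ)) κ μ →
      (∃ Q : Measure (Fin m → X), IsProbabilityMeasure Q ∧ S.IsSample μ φ Q id) ∧
      ∀ (Ω : Type*) [MeasurableSpace Ω] (P : Measure Ω) [IsProbabilityMeasure P]
        (x : Ω → Fin m → X), S.IsSample μ φ P x →
          (∀ᵐ ω ∂P, (∀ i, 0 < S.weights φ (x ω) i) ∧ ∃! v : V,
            BarrierSampling.IsLeastSquares b φ f (S.weights φ (x ω)) (x ω) v) ∧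
          ∀ ft : Ω → V,
            (∀ᵐ ω ∂P,
              BarrierSampling.IsLeastSquares b φ f (S.weights φ (x ω)) (x ω) (ft ω)) →
            (κ < 1 →
              ∫⁻ ω, BarrierSampling.errL2 f (ft ω) ^ 2 ∂P ≤
                ENNReal.ofReal (1 + 1 / (1 - κ) * (1 / (1 - 1 / √r) ^ 2)) *
                  BarrierSampling.bestError V 2 f ^ 2) ∧
            (0 < κ → (∀ v ∈ V, MemLp (v : X → ℂ) ∞ μ) →
              ∀ᵐ ω ∂P, BarrierSampling.errL2 f (ft ω) ≤
                ENNReal.ofReal (1 + 1 / √κ * (1 / (1 - 1 / √r))) *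
                  BarrierSampling.bestError V ∞ f)) := by
  have hn0 : (0 : ℝ) < n := by exact_mod_cast hn
  have hnm : (n : ℝ) ≤ m := by exact_mod_cast hm
  refine ⟨?_, ?_⟩
  · rintro r hr S rfl
    have hr1 : 1 < r := by
      rw [hr, lt_div_iff₀ hn0]
      linarith
    have hr0 : 0 < r := one_pos.trans hr1
    -- In terms of q = r^{1/4}: ε = q⁻¹, γ = q² - q and m + 1 = nq⁴.
    set q : ℝ := r ^ (1 / 4 : ℝ) with hq
    have hq1 : 1 < q := Real.one_lt_rpow hr1 (by norm_num)
    have e1 : r ^ (-(1 / 4) : ℝ) = q⁻¹ := Real.rpow_neg hr0.le _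
    have e2 : r ^ (1 / 2 : ℝ) = q ^ 2 := by
      rw [hq, ← Real.rpow_mul_natCast hr0.le]
      norm_num
    have e4 : r = q ^ 4 := by
      rw [hq, ← Real.rpow_mul_natCast hr0.le]
      norm_num
    rw [e1, e2]
    have hm' : (m : ℝ) + 1 = n * q ^ 4 := by
      rw [← e4, hr, mul_div_cancel₀ _ hn0.ne']
    have hq0 : 0 < q := one_pos.trans hq1
    have hε0 : 0 < q⁻¹ := inv_pos.2 hq0
    have hε : q⁻¹ < 1 := inv_lt_one_of_one_lt₀ hq1
    have hγ : 0 ≤ q ^ 2 - q := by nlinarith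
    refine ⟨?_, ?_⟩
    · obtain ⟨Q, hQ, hQS, -⟩ := Sampler.exists_isSample (effectiveResistance_isMeasurable hφm) hφm
        (effectiveResistance_isInvariant hn hφ hε0 hε hγ) m
      exact ⟨Q, hQ, hQS⟩
    · intro Ω _ P _ x hx E hE
      have hPE := le_measure_finalMatrix hn hφm hφ hq1 hm' hx
      have hEm : MeasurableSet E := hE ▸ measurableSet_finalMatrix hφm hx.1 _
      have hpos := effectiveResistance_ae_weights_pos hn hφm hφ hε0 hε hγ hx
      refine ⟨hEm, hE ▸ hPE, hpos, ?_, fun ft hft => ?_⟩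
      · filter_upwards [ProbabilityTheory.cond_absolutelyContinuous.ae_le hpos,
          ProbabilityTheory.ae_cond_mem hEm] with ω h1 h2
        rw [hE] at h2
        exact existsUnique_isLeastSquares b φ (x ω) (fun i => (h1 i).le)
          (mul_pos hn0 (sub_pos.2 hq1)) (mul_norm_sq_le_of_finalMatrix b h2) f
      · have h := lintegral_errL2_cond_le hn hφm hφ hf hq1 hm' hx hE hft
        rwa [← e4] at h
  · rintro hn2 r hr κ hκ hκ1 S rfl
    have hn1 : (0 : ℝ) < (n : ℝ) - 1 := by
      have : (2 : ℝ) ≤ n := by exact_mod_cast hn2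
      linarith
    have hr1 : 1 < r := by
      rw [hr, lt_div_iff₀ hn1]
      linarith
    have hr0 : 0 < r := one_pos.trans hr1
    have e1 : r ^ (-(1 / 2) : ℝ) = 1 / √r := by
      rw [Real.rpow_neg hr0.le, Real.sqrt_eq_rpow]
      exact (one_div _).symm
    rw [e1]
    set δ : ℝ := 1 / √r with hδdef
    have hs1 : 1 < √r := Real.lt_sqrt_of_sq_lt (by simpa using hr1)
    have hδ0 : 0 < δ := by positivity
    have hδ : δ < 1 := (div_lt_one (one_pos.trans hs1)).2 hs1
    have hm0 : 0 < m := hn.trans hm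
    -- With δ = 1/√r, mδ² = m/r = n - 1.
    have hm' : m * δ ^ 2 = (n : ℝ) - 1 := by
      have hm0' : (0 : ℝ) < m := by exact_mod_cast hm0
      rw [hδdef, div_pow, Real.sq_sqrt hr0.le, hr]
      field_simp
    refine ⟨?_, ?_⟩
    · obtain ⟨Q, hQ, hQS, -⟩ := Sampler.exists_isSample (fixedIncrements_isMeasurable hφm) hφm
        (fixedIncrements_isInvariant hn hφm hφ hδ0 hδ hκ hκ1) m
      exact ⟨Q, hQ, hQS⟩
    · intro Ω _ P _ x hx
      refine ⟨?_, fun ft hft => ⟨fun hκ' => ?_, fun hκ' _ => ?_⟩⟩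
      · filter_upwards [hx.ae_density_pos (fixedIncrements_isMeasurable hφm) hφm] with ω hω
        have hm0' : (0 : ℝ) < m := by exact_mod_cast hm0
        have hc : 0 < m * (δ * (1 - δ)) := mul_pos hm0' (mul_pos hδ0 (sub_pos.2 hδ))
        exact ⟨fun i => fixedIncrements_weight_pos hδ0 hδ hκ (hω i),
          existsUnique_isLeastSquares b φ (x ω)
            (fun i => fixedIncrements_weight_nonneg hδ0 hδ hκ _) hc
            (mul_norm_sq_le_of_finalMatrix b
              (fixedIncrements_posSemidef hn hφm hφ hδ0 hδ hκ hκ1 hm' hω)) f⟩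
      · exact lintegral_errL2_fixedIncrements_le hn hφm hφ hf hδ0 hδ hκ hκ' hm0 hm' hx hft
      · exact ae_errL2_fixedIncrements_le hn hφm hφ hf hδ0 hδ hκ' hκ1 hm0 hm' hx hft
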